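/- A visibility representation of a graph $G$ (on the integer grid) assigns to the vertices pairwise disjoint axis-parallel boxes (possibly degenerate to segments or points) and to every edge a horizontal or vertical segment that joins the boxes of its two endpoints, meets each of these two boxes only in the point where it ends, and meets no other vertex box; all corners of boxes and all ends of edge segments have integer coordinates. Its width (height) is the number of grid columns (rows) that intersect the drawing, and its area is width times height. An outer-1-plane graph is a graph with a fixed embedding, given by a drawing in which every edge is crossed at most once, edges with a common endpoint do not cross, and all vertices are on the outer face. A visibility representation is embedding-preserving if, walking counterclockwise around each vertex box, one meets the incident edges in the cyclic order of the given embedding, and the planarization of the representation (replace crossings by dummy vertices) has the same facial circuits as that of the given embedding. Theorem. There is a constant $c>0$ such that for every $N\in\mathbb N$ there is a connected outer-1-plane graph $G$ with $n\ge N$ vertices such that every embedding-preserving visibility representation of $G$ has area at least $c\,n^{3/2}$. -/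

import Mathlib

/-- A combinatorial embedding of a drawing of `G` in an oriented surface in which every edge is
crossed at most once.

* `rot d` is the counterclockwise next dart (directed edge) after `d` around the vertex `d.fst`.
* `cross d = d` if the edge of `d` is uncrossed. Otherwise the edge of `d` crosses the edge of
  `cross d`, and around the crossing point the counterclockwise next half-edge after the one that
  leads to `d.fst` is the one that leads to `(cross d).fst`. So the four half-edges at the crossing
  lead, in counterclockwise order, to the tails of `d`, `cross d`, `d.symm`, `(cross d).symm`. -/
structure OnePlaneEmbedding {V : Type*} (G : SimpleGraph V) where
  rot : Equiv.Perm G.Dart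
  cross : Equiv.Perm G.Dart
  /-- The darts that leave a common vertex form exactly one cycle of `rot`. -/
  rot_sameCycle : ∀ d e : G.Dart, rot.SameCycle d e ↔ d.fst = e.fst
  cross_cross : ∀ d : G.Dart, cross d ≠ d → cross (cross d) = d.symm
  /-- Edges with a common endpoint do not cross (stated for all darts, this covers all four pairs
  of endpoints of the two crossing edges). -/
  cross_fst_ne : ∀ d : G.Dart, cross d ≠ d → (cross d).fst ≠ d.fst

namespace OnePlaneEmbedding

variable {V : Type*} {G : SimpleGraph V} (E : OnePlaneEmbedding G)

theorem cross_symm {d : G.Dart} (h : E.cross d = d) : E.cross d.symm = d.symm := by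
  by_contra h'
  have h1 := E.cross_cross _ h'
  rw [SimpleGraph.Dart.symm_symm] at h1
  have h2 : E.cross d.symm = d := E.cross.injective (h1.trans h.symm)
  have h3 : d.symm = d := E.cross.injective (h2.trans h.symm)
  exact SimpleGraph.Dart.symm_ne d h3

theorem cross_cross_ne {d : G.Dart} (h : E.cross d ≠ d) : E.cross (E.cross d) ≠ E.cross d :=
  fun h' => h (E.cross.injective h')

/-- The darts of the planarization (each crossing point becomes a dummy vertex).
`(d, false)` leaves the vertex `d.fst` along the edge of `d`; for a crossed edge, `(d, true)`
leaves the crossing point towards the vertex `d.fst`. -/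
abbrev PlanDart : Type _ :=
  {p : G.Dart × Bool // p.2 = true → E.cross p.1 ≠ p.1}

/-- The dart of the planarization that leaves the vertex `d.fst` along the edge of `d`. -/
def ofDart (d : G.Dart) : E.PlanDart := ⟨(d, false), by simp⟩

open Classical in
/-- Reversal of the darts of the planarization, as a function. -/
noncomputable def planRevFun (p : E.PlanDart) : E.PlanDart :=
  if h : E.cross p.1.1 = p.1.1 then ⟨(p.1.1.symm, false), by simp⟩
  else ⟨(p.1.1, !p.1.2), fun _ => h⟩

theorem planRevFun_involutive : Function.Involutive E.planRevFun := by
  rintro ⟨⟨d, b⟩, hb⟩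
  by_cases h : E.cross d = d
  · have hb' : b = false := by
      cases b
      · rfl
      · exact absurd h (hb rfl)
    subst hb'
    simp [planRevFun, h, E.cross_symm h]
  · simp [planRevFun, h]

/-- Reversal of the darts of the planarization; its cycles are the edges of the planarization. -/
noncomputable def planRev : Equiv.Perm E.PlanDart := E.planRevFun_involutive.toPerm

/-- The counterclockwise rotation of the planarization around its vertices and dummy vertices;
its cycles are the vertices and dummy vertices (if `G` has no isolated vertex). -/
def planRot : Equiv.Perm E.PlanDart where
  toFun p := match p with
    | ⟨(d, false), _⟩ => ⟨(E.rot d, false), by simp⟩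
    | ⟨(d, true), h⟩ => ⟨(E.cross d, true), fun _ => E.cross_cross_ne (h rfl)⟩
  invFun p := match p with
    | ⟨(d, false), _⟩ => ⟨(E.rot.symm d, false), by simp⟩
    | ⟨(d, true), h⟩ => ⟨(E.cross.symm d, true), fun _ h' => h rfl (by
        simp only [Equiv.apply_symm_apply] at h'
        exact (Equiv.eq_symm_apply _).1 h')⟩
  left_inv := by
    rintro ⟨⟨d, _ | _⟩, h⟩ <;> simp
  right_inv := by
    rintro ⟨⟨d, _ | _⟩, h⟩ <;> simp

/-- The face permutation: follow a dart to its end, then turn to the next dart there. Its cycles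
are the facial circuits of the planarization. -/
noncomputable def planFace : Equiv.Perm E.PlanDart := E.planRev.trans E.planRot

/-- The number of cycles of a permutation, fixed points included. -/
noncomputable def numCycles {α : Type*} (f : Equiv.Perm α) : ℕ :=
  Nat.card (Quotient (Equiv.Perm.SameCycle.setoid f))

/-- `E` is an outer-1-planar embedding of the connected graph `G` (with at least one edge): the
planarization is embedded in the sphere (Euler's formula), and some face, taken as the outer
face, is incident to all vertices of `G`. -/
structure IsConnectedOuterOnePlane : Prop where
  connected : G.Connected
  euler : numCycles E.planRot + numCycles E.planFace = numCycles E.planRev + 2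
  outer : ∃ p : E.PlanDart, ∀ v : V, ∃ d : G.Dart, d.fst = v ∧
    E.planFace.SameCycle p (E.ofDart d)

end OnePlaneEmbedding

/-- A bi-directional rectangle visibility representation of `G` on the integer grid. The vertex
`v` is the box `[left v, right v] × [bottom v, top v]`, possibly a segment or a point. The edge of
a dart `d` is the segment from `port d` on the box of `d.fst` to `port d.symm` on the box of
`d.snd`. All corners and ports are grid points and all segments are axis-parallel, so boxes and
segments meet if and only if they have a common grid point; it suffices to speak of grid points. -/
structure VisibilityRep {V : Type*} (G : SimpleGraph V) where
  left : V → ℤ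
  right : V → ℤ
  bottom : V → ℤ
  top : V → ℤ
  left_le_right : ∀ v, left v ≤ right v
  bottom_le_top : ∀ v, bottom v ≤ top v
  port : G.Dart → ℤ × ℤ
  /-- Boxes of distinct vertices are disjoint. -/
  box_disjoint : ∀ u v, u ≠ v →
    Disjoint (Set.Icc (left u, bottom u) (right u, top u))
      (Set.Icc (left v, bottom v) (right v, top v))
  /-- Edges are vertical or horizontal. -/
  aligned : ∀ d : G.Dart, (port d).1 = (port d.symm).1 ∨ (port d).2 = (port d.symm).2
  /-- An edge meets the box of an endpoint exactly in the point where it ends. -/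
  seg_inter_box : ∀ d : G.Dart,
    Set.uIcc (port d) (port d.symm) ∩ Set.Icc (left d.fst, bottom d.fst) (right d.fst, top d.fst)
      = {port d}
  /-- An edge meets no other box. -/
  seg_disjoint_box : ∀ (d : G.Dart) (w : V), w ≠ d.fst → w ≠ d.snd →
    Disjoint (Set.uIcc (port d) (port d.symm)) (Set.Icc (left w, bottom w) (right w, top w))

namespace VisibilityRep

variable {V : Type*} {G : SimpleGraph V} (Γ : VisibilityRep G)

/-- The grid points of the box of `v`. -/
def box (v : V) : Set (ℤ × ℤ) := Set.Icc (Γ.left v, Γ.bottom v) (Γ.right v, Γ.top v)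

/-- The grid points of the segment of the edge of `d`. -/
def seg (d : G.Dart) : Set (ℤ × ℤ) := Set.uIcc (Γ.port d) (Γ.port d.symm)

/-- The grid points of the drawing. -/
def support : Set (ℤ × ℤ) := (⋃ v, Γ.box v) ∪ ⋃ d, Γ.seg d

/-- The number of grid columns that meet the drawing. -/
noncomputable def width : ℕ := {x : ℤ | ∃ y, (x, y) ∈ Γ.support}.ncard

/-- The number of grid rows that meet the drawing. -/
noncomputable def height : ℕ := {y : ℤ | ∃ x, (x, y) ∈ Γ.support}.ncard

noncomputable def area : ℕ := Γ.width * Γ.height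

/-- The direction in which the edge of `d` leaves the box of `d.fst`: `0` rightward, `1` upward,
`2` leftward, `3` downward. Adding `1` (modulo 4) is a counterclockwise quarter turn. -/
def dir (d : G.Dart) : Fin 4 :=
  if (Γ.port d).1 < (Γ.port d.symm).1 then 0
  else if (Γ.port d.symm).1 < (Γ.port d).1 then 2
  else if (Γ.port d).2 < (Γ.port d.symm).2 then 1
  else 3

/-- The position along the side of the box where the edge of `d` leaves, increasing
counterclockwise around the box. -/
def offset (d : G.Dart) : ℤ :=
  match Γ.dir d with
  | 0 => (Γ.port d).2
  | 1 => -(Γ.port d).1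
  | 2 => -(Γ.port d).2
  | 3 => (Γ.port d).1

/-- The place of `d` on the counterclockwise walk around the box of `d.fst` that starts at the
lower right corner and goes along the right, top, left and bottom side. -/
def place (d : G.Dart) : Fin 4 ×ₗ ℤ := toLex (Γ.dir d, Γ.offset d)

/-- On the counterclockwise walk around their common box, starting at `d`, the dart `f` is met
strictly between `d` and `e`. -/
def Between (d f e : G.Dart) : Prop :=
  (Γ.place d < Γ.place f ∧ Γ.place f < Γ.place e) ∨
  (Γ.place f < Γ.place e ∧ Γ.place e < Γ.place d) ∨
  (Γ.place e < Γ.place d ∧ Γ.place d < Γ.place f)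

/-- The segments of `d` and `e` cross: they have a common point that is not an endpoint. -/
def Crosses (d e : G.Dart) : Prop :=
  ∃ q ∈ Γ.seg d ∩ Γ.seg e,
    q ≠ Γ.port d ∧ q ≠ Γ.port d.symm ∧ q ≠ Γ.port e ∧ q ≠ Γ.port e.symm

/-- `Γ` preserves the embedding `E`: a counterclockwise walk around each box meets the incident
edges in the cyclic order that `E` prescribes, and the planarization of `Γ` is that of `E`, that
is, the same edges cross, with the same cyclic order at each crossing. (The face permutation of
the planarization is determined by these orders and determines them, so this says that the facial
circuits are the same.) -/
structure EmbeddingPreserving (E : OnePlaneEmbedding G) : Prop where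
  rot : ∀ d f : G.Dart, f.fst = d.fst → ¬ Γ.Between d f (E.rot d)
  cross : ∀ d e : G.Dart, (e ≠ d ∧ E.cross d = e) ↔ (Γ.Crosses d e ∧ Γ.dir e = Γ.dir d + 1)

end VisibilityRep

/-!
A graph is built such that every embedding-preserving representation has width and height at least
`q`, and width or height at least about `q ^ 2`, while the number of vertices is of order `q ^ 2`.

The graph is a spider: a tree with a centre and three legs of `q` vertices each, in which many
leaves are inserted into the angles between the edges of the legs. These edges are called links.
On both sides of each link `uv`, the leaf edge of `u` next to the link crosses the leaf edge of `v`
next to it. So the planarization has one triangular face on each side of each link, and all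
vertices are on the one remaining face. One angle at the centre has more than `q ^ 2` leaves; as
every dart at a box needs its own row or its own column, one of the dimensions is at least about
`q ^ 2 / 4`.

It remains to bound the height from below by `q`; a quarter turn of the representation
(`VisibilityRep.rotate`) gives the same for the width. Suppose that the height is less than `q`.
The darts that leave a vertical side of a box use distinct rows, so fewer than `q` darts do. As
there are at least `q` leaves between any two links of a vertex, each vertical side of a box can
serve only one link, together with the crossed leaf edges next to it
(`LinkMap.dir_trio_ne`). At the centre there are three links and two vertical sides, so for some
leg, the first link and its two neighbours are vertical at the centre (`LinkMap.exists_straight`);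
say that they point downward. The leaf edges that they cross are then horizontal and leave the next
vertex to the left and to the right, so both vertical sides of its box are used, and its top side
carries nothing but the link (`VisibilityRep.EmbeddingPreserving.link`). Hence the next link and its
neighbours point downward again (`LinkMap.Straight.next`). So the whole leg is drawn downward, and
its `q` vertices use distinct rows (`LinkMap.Straight.le_height`).

To check that the graph is outer-1-plane, it is described by a combinatorial map of its skeleton
(`LinkMap`). If the skeleton is a plane tree, then the cycles of the three permutations of the
planarization can be listed, which gives Euler's formula
(`LinkMap.isConnectedOuterOnePlane`).
-/

/-! ### Geometry of a visibility representation -/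

namespace VisibilityRep

variable {V : Type*} {G : SimpleGraph V} (Γ : VisibilityRep G)

theorem mem_seg {d : G.Dart} {q : ℤ × ℤ} : q ∈ Γ.seg d ↔
    (min (Γ.port d).1 (Γ.port d.symm).1 ≤ q.1 ∧ q.1 ≤ max (Γ.port d).1 (Γ.port d.symm).1) ∧
    (min (Γ.port d).2 (Γ.port d.symm).2 ≤ q.2 ∧ q.2 ≤ max (Γ.port d).2 (Γ.port d.symm).2) := by
  simp only [seg, Set.uIcc, Set.mem_Icc, Prod.le_def, Prod.fst_inf, Prod.snd_inf, Prod.fst_sup,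
    Prod.snd_sup]
  tauto

theorem mem_box {v : V} {q : ℤ × ℤ} : q ∈ Γ.box v ↔
    (Γ.left v ≤ q.1 ∧ q.1 ≤ Γ.right v) ∧ (Γ.bottom v ≤ q.2 ∧ q.2 ≤ Γ.top v) := by
  simp only [box, Set.mem_Icc, Prod.le_def]
  tauto

theorem port_mem_box (d : G.Dart) : Γ.port d ∈ Γ.box d.fst := by
  have h : Γ.port d ∈ ({Γ.port d} : Set (ℤ × ℤ)) := rfl
  rw [← Γ.seg_inter_box d] at h
  exact h.2

theorem port_symm_mem_box (d : G.Dart) : Γ.port d.symm ∈ Γ.box d.snd := Γ.port_mem_box d.symm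

theorem eq_port_of_mem {d : G.Dart} {q : ℤ × ℤ} (h : q ∈ Γ.seg d) (h' : q ∈ Γ.box d.fst) :
    q = Γ.port d := by
  have : q ∈ ({Γ.port d} : Set (ℤ × ℤ)) := Γ.seg_inter_box d ▸ ⟨h, h'⟩
  exact this

theorem port_ne (d : G.Dart) : Γ.port d ≠ Γ.port d.symm := fun h =>
  Set.disjoint_left.1 (Γ.box_disjoint _ _ d.adj.ne) (Γ.port_mem_box d)
    (h ▸ Γ.port_symm_mem_box d)

/-- What the direction of a dart says about its two ports. -/
theorem dir_cases (d : G.Dart) :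
    (Γ.dir d = 0 ∧ (Γ.port d).1 < (Γ.port d.symm).1 ∧ (Γ.port d).2 = (Γ.port d.symm).2) ∨
    (Γ.dir d = 1 ∧ (Γ.port d).1 = (Γ.port d.symm).1 ∧ (Γ.port d).2 < (Γ.port d.symm).2) ∨
    (Γ.dir d = 2 ∧ (Γ.port d.symm).1 < (Γ.port d).1 ∧ (Γ.port d).2 = (Γ.port d.symm).2) ∨
    (Γ.dir d = 3 ∧ (Γ.port d).1 = (Γ.port d.symm).1 ∧ (Γ.port d.symm).2 < (Γ.port d).2) := by
  have hne : (Γ.port d).1 = (Γ.port d.symm).1 → (Γ.port d).2 ≠ (Γ.port d.symm).2 := fun h h' =>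
    Γ.port_ne d (Prod.ext h h')
  have hal := Γ.aligned d
  unfold dir
  split_ifs with h1 h2 h3
  · exact Or.inl ⟨rfl, h1, by omega⟩
  · exact Or.inr (Or.inr (Or.inl ⟨rfl, h2, by omega⟩))
  · exact Or.inr (Or.inl ⟨rfl, by omega, h3⟩)
  · have := hne (by omega)
    exact Or.inr (Or.inr (Or.inr ⟨rfl, by omega, by omega⟩))

theorem of_dir_zero {d : G.Dart} (h : Γ.dir d = 0) :
    (Γ.port d).1 < (Γ.port d.symm).1 ∧ (Γ.port d).2 = (Γ.port d.symm).2 := by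
  rcases Γ.dir_cases d with ⟨h', p⟩ | ⟨h', p⟩ | ⟨h', p⟩ | ⟨h', p⟩ <;>
    first | exact p | (rw [h] at h'; exact absurd h' (by decide))

theorem of_dir_one {d : G.Dart} (h : Γ.dir d = 1) :
    (Γ.port d).1 = (Γ.port d.symm).1 ∧ (Γ.port d).2 < (Γ.port d.symm).2 := by
  rcases Γ.dir_cases d with ⟨h', p⟩ | ⟨h', p⟩ | ⟨h', p⟩ | ⟨h', p⟩ <;>
    first | exact p | (rw [h] at h'; exact absurd h' (by decide))

theorem of_dir_two {d : G.Dart} (h : Γ.dir d = 2) :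
    (Γ.port d.symm).1 < (Γ.port d).1 ∧ (Γ.port d).2 = (Γ.port d.symm).2 := by
  rcases Γ.dir_cases d with ⟨h', p⟩ | ⟨h', p⟩ | ⟨h', p⟩ | ⟨h', p⟩ <;>
    first | exact p | (rw [h] at h'; exact absurd h' (by decide))

theorem of_dir_three {d : G.Dart} (h : Γ.dir d = 3) :
    (Γ.port d).1 = (Γ.port d.symm).1 ∧ (Γ.port d.symm).2 < (Γ.port d).2 := by
  rcases Γ.dir_cases d with ⟨h', p⟩ | ⟨h', p⟩ | ⟨h', p⟩ | ⟨h', p⟩ <;>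
    first | exact p | (rw [h] at h'; exact absurd h' (by decide))

theorem dir_symm (d : G.Dart) : Γ.dir d.symm = Γ.dir d + 2 := by
  have h := Γ.dir_cases d.symm
  simp only [SimpleGraph.Dart.symm_symm] at h
  rcases Γ.dir_cases d with ⟨h', p, q⟩ | ⟨h', p, q⟩ | ⟨h', p, q⟩ | ⟨h', p, q⟩ <;>
    rcases h with ⟨k', r, s⟩ | ⟨k', r, s⟩ | ⟨k', r, s⟩ | ⟨k', r, s⟩ <;>
    omega

theorem port_zero {d : G.Dart} (h : Γ.dir d = 0) : (Γ.port d).1 = Γ.right d.fst := by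
  have ⟨h1, h2⟩ := Γ.of_dir_zero h
  have hb := Γ.mem_box.1 (Γ.port_mem_box d)
  by_contra hne
  have := Γ.eq_port_of_mem (d := d) (q := ((Γ.port d).1 + 1, (Γ.port d).2))
    (Γ.mem_seg.2 (by simp only; omega)) (Γ.mem_box.2 (by simp only; omega))
  have := congrArg Prod.fst this
  simp at this

theorem port_one {d : G.Dart} (h : Γ.dir d = 1) : (Γ.port d).2 = Γ.top d.fst := by
  have ⟨h1, h2⟩ := Γ.of_dir_one h
  have hb := Γ.mem_box.1 (Γ.port_mem_box d)
  by_contra hne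
  have := Γ.eq_port_of_mem (d := d) (q := ((Γ.port d).1, (Γ.port d).2 + 1))
    (Γ.mem_seg.2 (by simp only; omega)) (Γ.mem_box.2 (by simp only; omega))
  have := congrArg Prod.snd this
  simp at this

theorem port_two {d : G.Dart} (h : Γ.dir d = 2) : (Γ.port d).1 = Γ.left d.fst := by
  have ⟨h1, h2⟩ := Γ.of_dir_two h
  have hb := Γ.mem_box.1 (Γ.port_mem_box d)
  by_contra hne
  have := Γ.eq_port_of_mem (d := d) (q := ((Γ.port d).1 - 1, (Γ.port d).2))
    (Γ.mem_seg.2 (by simp only; omega)) (Γ.mem_box.2 (by simp only; omega))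
  have := congrArg Prod.fst this
  simp at this

theorem port_three {d : G.Dart} (h : Γ.dir d = 3) : (Γ.port d).2 = Γ.bottom d.fst := by
  have ⟨h1, h2⟩ := Γ.of_dir_three h
  have hb := Γ.mem_box.1 (Γ.port_mem_box d)
  by_contra hne
  have := Γ.eq_port_of_mem (d := d) (q := ((Γ.port d).1, (Γ.port d).2 - 1))
    (Γ.mem_seg.2 (by simp only; omega)) (Γ.mem_box.2 (by simp only; omega))
  have := congrArg Prod.snd this
  simp at this

/-- If `d` ends on the segment of another dart `e` of the same vertex, then that segment meets the
box of the head of `d`, so this vertex is also the head of `e`. -/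
theorem eq_of_port_symm_mem_seg {d e : G.Dart} (hv : d.fst = e.fst)
    (h : Γ.port d.symm ∈ Γ.seg e) : d = e := by
  by_cases hs : d.snd = e.snd
  · exact SimpleGraph.Dart.ext _ _ (Prod.ext hv hs)
  · exact absurd (Γ.port_symm_mem_box d)
      (Set.disjoint_left.1 (Γ.seg_disjoint_box e d.snd (hv ▸ d.adj.ne.symm) hs) h)

/-- Distinct darts of a vertex leave its box at distinct places. -/
theorem place_injective {d e : G.Dart} (hv : d.fst = e.fst) (h : Γ.place d = Γ.place e) :
    d = e := by
  have hdir : Γ.dir d = Γ.dir e := congrArg (fun p => (ofLex p).1) h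
  have hoff : Γ.offset d = Γ.offset e := congrArg (fun p => (ofLex p).2) h
  have key : Γ.port d.symm ∈ Γ.seg e ∨ Γ.port e.symm ∈ Γ.seg d := by
    simp only [mem_seg]
    unfold offset at hoff
    rw [← hdir] at hoff
    rcases Γ.dir_cases d with ⟨h', p, q⟩ | ⟨h', p, q⟩ | ⟨h', p, q⟩ | ⟨h', p, q⟩ <;>
      simp only [h'] at hoff
    · have := Γ.of_dir_zero (hdir ▸ h')
      have h1 := Γ.port_zero h'
      have h2 := Γ.port_zero (hdir ▸ h')
      rw [hv] at h1
      omega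
    · have := Γ.of_dir_one (hdir ▸ h')
      have h1 := Γ.port_one h'
      have h2 := Γ.port_one (hdir ▸ h')
      rw [hv] at h1
      omega
    · have := Γ.of_dir_two (hdir ▸ h')
      have h1 := Γ.port_two h'
      have h2 := Γ.port_two (hdir ▸ h')
      rw [hv] at h1
      omega
    · have := Γ.of_dir_three (hdir ▸ h')
      have h1 := Γ.port_three h'
      have h2 := Γ.port_three (hdir ▸ h')
      rw [hv] at h1
      omega
  rcases key with h | h
  · exact Γ.eq_of_port_symm_mem_seg hv h
  · exact (Γ.eq_of_port_symm_mem_seg hv.symm h).symm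

theorem port_mem_support (d : G.Dart) : Γ.port d ∈ Γ.support :=
  Or.inl (Set.mem_iUnion.2 ⟨_, Γ.port_mem_box d⟩)

theorem support_finite [Finite V] : Γ.support.Finite := by
  have : Finite G.Dart :=
    Finite.of_injective (fun d : G.Dart => d.toProd) SimpleGraph.Dart.toProd_injective
  exact (Set.finite_iUnion fun v => Set.finite_Icc _ _).union
    (Set.finite_iUnion fun d => Set.finite_Icc _ _)

theorem rows_finite [Finite V] : {y : ℤ | ∃ x, (x, y) ∈ Γ.support}.Finite :=
  (Γ.support_finite.image Prod.snd).subset fun y ⟨x, h⟩ => ⟨(x, y), h, rfl⟩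

theorem columns_finite [Finite V] : {x : ℤ | ∃ y, (x, y) ∈ Γ.support}.Finite :=
  (Γ.support_finite.image Prod.fst).subset fun x ⟨y, h⟩ => ⟨(x, y), h, rfl⟩

theorem card_le_height_of_injOn [Finite V] {ι : Type*} (s : Finset ι) (f : ι → ℤ)
    (hf : Set.InjOn f s) (h : ∀ i ∈ s, ∃ x, (x, f i) ∈ Γ.support) : s.card ≤ Γ.height := by
  rw [height, ← Set.ncard_coe_finset s, ← hf.ncard_image]
  exact Set.ncard_le_ncard (Set.image_subset_iff.2 fun i hi => h i hi) Γ.rows_finite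

theorem card_le_width_of_injOn [Finite V] {ι : Type*} (s : Finset ι) (f : ι → ℤ)
    (hf : Set.InjOn f s) (h : ∀ i ∈ s, ∃ y, (f i, y) ∈ Γ.support) : s.card ≤ Γ.width := by
  rw [width, ← Set.ncard_coe_finset s, ← hf.ncard_image]
  exact Set.ncard_le_ncard (Set.image_subset_iff.2 fun i hi => h i hi) Γ.columns_finite

theorem place_eq_of_port {d e : G.Dart} (h : Γ.dir d = Γ.dir e)
    (h' : (Γ.dir d = 0 ∨ Γ.dir d = 2) ∧ (Γ.port d).2 = (Γ.port e).2 ∨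
      (Γ.dir d = 1 ∨ Γ.dir d = 3) ∧ (Γ.port d).1 = (Γ.port e).1) :
    Γ.place d = Γ.place e := by
  unfold place offset
  rw [← h]
  rcases h' with ⟨h1 | h1, h2⟩ | ⟨h1 | h1, h2⟩ <;> simp only [h1, h2]

/-- The darts that leave one vertical side of a box use distinct rows. -/
theorem card_darts_le_height [Finite V] (s : Finset G.Dart) (v : V) (δ : Fin 4)
    (hδ : δ = 0 ∨ δ = 2) (h : ∀ d ∈ s, d.fst = v ∧ Γ.dir d = δ) : s.card ≤ Γ.height := by
  refine Γ.card_le_height_of_injOn s (fun d => (Γ.port d).2) ?_ fun d _ =>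
    ⟨_, Γ.port_mem_support d⟩
  intro d hd e he hde
  refine Γ.place_injective ((h d hd).1.trans (h e he).1.symm)
    (Γ.place_eq_of_port ((h d hd).2.trans (h e he).2.symm) (Or.inl ⟨?_, hde⟩))
  rwa [(h d hd).2]

theorem card_darts_le_width [Finite V] (s : Finset G.Dart) (v : V) (δ : Fin 4)
    (hδ : δ = 1 ∨ δ = 3) (h : ∀ d ∈ s, d.fst = v ∧ Γ.dir d = δ) : s.card ≤ Γ.width := by
  refine Γ.card_le_width_of_injOn s (fun d => (Γ.port d).1) ?_ fun d _ =>
    ⟨_, Γ.port_mem_support d⟩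
  intro d hd e he hde
  refine Γ.place_injective ((h d hd).1.trans (h e he).1.symm)
    (Γ.place_eq_of_port ((h d hd).2.trans (h e he).2.symm) (Or.inr ⟨?_, hde⟩))
  rwa [(h d hd).2]

/-- A vertex of large degree forces a large width or a large height. -/
theorem card_darts_le [Finite V] (s : Finset G.Dart) (v : V) (h : ∀ d ∈ s, d.fst = v) :
    s.card ≤ 2 * Γ.width + 2 * Γ.height := by
  rw [Finset.card_eq_sum_card_fiberwise (t := Finset.univ) (f := Γ.dir) (by simp [Set.MapsTo]),
    Fin.sum_univ_four]
  have key : ∀ δ : Fin 4, ∀ d ∈ s.filter (fun d => Γ.dir d = δ), d.fst = v ∧ Γ.dir d = δ :=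
    fun δ d hd => ⟨h d (Finset.mem_filter.1 hd).1, (Finset.mem_filter.1 hd).2⟩
  have h0 := Γ.card_darts_le_height _ v 0 (by simp) (key 0)
  have h1 := Γ.card_darts_le_width _ v 1 (by simp) (key 1)
  have h2 := Γ.card_darts_le_height _ v 2 (by simp) (key 2)
  have h3 := Γ.card_darts_le_width _ v 3 (by simp) (key 3)
  omega

theorem dir_le_of_place_le {d e : G.Dart} (h : Γ.place d ≤ Γ.place e) : Γ.dir d ≤ Γ.dir e := by
  unfold place at h
  rw [Prod.Lex.toLex_le_toLex] at h
  rcases h with h | h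
  · exact h.le
  · exact h.1.le

end VisibilityRep

namespace OnePlaneEmbedding

variable {V : Type*} {G : SimpleGraph V} (E : OnePlaneEmbedding G)

theorem rot_fst (d : G.Dart) : (E.rot d).fst = d.fst :=
  (E.rot_sameCycle _ _).1 (Equiv.Perm.sameCycle_apply_left.2 (Equiv.Perm.SameCycle.refl _ _))

theorem rot_iterate_fst (d : G.Dart) (i : ℕ) : (E.rot^[i] d).fst = d.fst := by
  induction i with
  | zero => rfl
  | succ i ih => rw [Function.iterate_succ_apply', rot_fst, ih]

end OnePlaneEmbedding

namespace VisibilityRep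

variable {V : Type*} {G : SimpleGraph V} {Γ : VisibilityRep G} {E : OnePlaneEmbedding G}

/-- Along the rotation from `d` towards a dart `e` at a later place, the places increase and stay
before that of `e` until `e` is met. -/
theorem EmbeddingPreserving.walk (hΓ : Γ.EmbeddingPreserving E) {d e : G.Dart}
    (hv : d.fst = e.fst) (hlt : Γ.place d < Γ.place e) (n : ℕ)
    (hn : ∀ i ≤ n, E.rot^[i] d ≠ e) :
    (∀ i ≤ n, Γ.place d ≤ Γ.place (E.rot^[i] d) ∧ Γ.place (E.rot^[i] d) < Γ.place e) ∧
      ∀ i < n, Γ.place (E.rot^[i] d) < Γ.place (E.rot^[i + 1] d) := by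
  induction n with
  | zero =>
    refine ⟨fun i hi => ?_, fun i hi => absurd hi (by omega)⟩
    obtain rfl : i = 0 := by omega
    exact ⟨le_rfl, hlt⟩
  | succ n ih =>
    obtain ⟨ih1, ih2⟩ := ih fun i hi => hn i (by omega)
    set f := E.rot^[n] d with hf
    have hfn := ih1 n le_rfl
    have hfv : f.fst = e.fst := (E.rot_iterate_fst d n).trans hv
    have hsucc : E.rot^[n + 1] d = E.rot f := Function.iterate_succ_apply' _ _ _
    have hb := hΓ.rot f e hfv.symm
    have hne : Γ.place (E.rot f) ≠ Γ.place e := fun h =>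
      hn (n + 1) le_rfl (hsucc.trans (Γ.place_injective ((E.rot_fst f).trans hfv) h))
    have hlt1 : Γ.place (E.rot f) < Γ.place e := by
      refine lt_of_le_of_ne (not_lt.1 fun h => hb (Or.inl ⟨hfn.2, h⟩)) hne
    have hne2 : Γ.place f ≠ Γ.place (E.rot f) := by
      intro h
      have hff : f = E.rot f := Γ.place_injective (E.rot_fst f).symm h
      -- a fixed dart of `rot` is the only dart of its vertex
      have hsc : E.rot.SameCycle f e := (E.rot_sameCycle _ _).2 hfv
      obtain ⟨k, hk⟩ := hsc
      rw [Equiv.Perm.zpow_apply_eq_self_of_apply_eq_self hff.symm] at hk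
      exact hn n (by omega) hk
    have hlt2 : Γ.place f < Γ.place (E.rot f) :=
      lt_of_le_of_ne (not_lt.1 fun h => hb (Or.inr (Or.inr ⟨h, hfn.2⟩))) hne2
    refine ⟨fun i hi => ?_, fun i hi => ?_⟩
    · rcases Nat.lt_or_ge n i with h | h
      · obtain rfl : i = n + 1 := by omega
        rw [hsucc]
        exact ⟨hfn.1.trans hlt2.le, hlt1⟩
      · exact ih1 i h
    · rcases Nat.lt_or_ge i n with h | h
      · exact ih2 i h
      · obtain rfl : i = n := by omega
        rw [hsucc]
        exact hlt2

/-- All darts on the way from `d` to `e` leave the same vertical side as `d` and `e`, each in a row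
of its own. -/
theorem EmbeddingPreserving.not_far_of_place_lt [Finite V] (hΓ : Γ.EmbeddingPreserving E)
    {d e : G.Dart} (hv : d.fst = e.fst) (hdir : Γ.dir d = Γ.dir e)
    (hh : Γ.dir d = 0 ∨ Γ.dir d = 2) (hlt : Γ.place d < Γ.place e) :
    ∃ i ≤ Γ.height, E.rot^[i] d = e := by
  by_contra! hn
  obtain ⟨h1, h2⟩ := hΓ.walk hv hlt Γ.height hn
  have hmono : StrictMonoOn (fun i => Γ.place (E.rot^[i] d)) (Set.Iic Γ.height) := by
    refine strictMonoOn_of_lt_add_one Set.ordConnected_Iic fun i _ _ hi => h2 i ?_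
    exact Nat.lt_of_succ_le hi
  classical
  have hinj : Set.InjOn (fun i => E.rot^[i] d) (Finset.range (Γ.height + 1)) := by
    intro i hi j hj hij
    have hi' := Finset.mem_range.1 hi
    have hj' := Finset.mem_range.1 hj
    exact hmono.injOn (Nat.le_of_lt_succ hi') (Nat.le_of_lt_succ hj')
      (congrArg Γ.place hij)
  have hc := Γ.card_darts_le_height ((Finset.range (Γ.height + 1)).image fun i => E.rot^[i] d)
    d.fst (Γ.dir d) hh (by
      intro f hf
      obtain ⟨i, hi, rfl⟩ := Finset.mem_image.1 hf
      have := h1 i (Nat.le_of_lt_succ (Finset.mem_range.1 hi))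
      exact ⟨E.rot_iterate_fst d i, le_antisymm
        (hdir ▸ Γ.dir_le_of_place_le this.2.le) (Γ.dir_le_of_place_le this.1)⟩)
  rw [Finset.card_image_of_injOn hinj, Finset.card_range] at hc
  omega

/-- Two darts that leave the same vertical side of a box are close to each other in the rotation,
because all darts between them need their own rows. -/
theorem EmbeddingPreserving.not_far [Finite V] (hΓ : Γ.EmbeddingPreserving E)
    {d e : G.Dart} (hv : d.fst = e.fst) (hdir : Γ.dir d = Γ.dir e)
    (hh : Γ.dir d = 0 ∨ Γ.dir d = 2) :
    ∃ i ≤ Γ.height, E.rot^[i] d = e ∨ E.rot^[i] e = d := by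
  rcases lt_trichotomy (Γ.place d) (Γ.place e) with h | h | h
  · obtain ⟨i, hi, h⟩ := hΓ.not_far_of_place_lt hv hdir hh h
    exact ⟨i, hi, Or.inl h⟩
  · exact ⟨0, Nat.zero_le _, Or.inl (Γ.place_injective hv h)⟩
  · obtain ⟨i, hi, h⟩ := hΓ.not_far_of_place_lt hv.symm hdir.symm (hdir ▸ hh) h
    exact ⟨i, hi, Or.inr h⟩

/-- If the darts `d`, `rot d`, `rot (rot d)` leave a box on three different sides, in this
counterclockwise order, then no other dart leaves the middle one of these sides. -/
theorem EmbeddingPreserving.eq_rot_of_dir_eq (hΓ : Γ.EmbeddingPreserving E) {d f : G.Dart}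
    (hv : f.fst = d.fst) (h1 : Γ.dir d + 1 = Γ.dir (E.rot d))
    (h2 : Γ.dir (E.rot d) + 1 = Γ.dir (E.rot (E.rot d))) (hf : Γ.dir f = Γ.dir (E.rot d)) :
    f = E.rot d := by
  by_contra hne
  have hb1 := hΓ.rot d f hv
  have hb2 := hΓ.rot (E.rot d) f (hv.trans (E.rot_fst d).symm)
  have hpl : Γ.place f ≠ Γ.place (E.rot d) := fun h =>
    hne (Γ.place_injective (hv.trans (E.rot_fst d).symm) h)
  unfold Between at hb1 hb2
  unfold place at hb1 hb2 hpl
  rw [← h2] at hb2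
  rw [hf, ← h1] at hb1 hb2 hpl
  simp only [Prod.Lex.toLex_lt_toLex, ne_eq, EmbeddingLike.apply_eq_iff_eq, Prod.mk.injEq,
    true_and] at hb1 hb2 hpl
  generalize Γ.dir d = δ at hb1 hb2
  rcases lt_or_gt_of_ne hpl with h | h
  · fin_cases δ <;> simp_all
  · fin_cases δ <;> simp_all

end VisibilityRep

/-! ### Two vertices whose neighbouring leaf edges cross -/

namespace VisibilityRep

variable {V : Type*} {G : SimpleGraph V} {Γ : VisibilityRep G} {E : OnePlaneEmbedding G}

theorem Crosses.exists_mem_rows {d e : G.Dart} (h : Γ.Crosses d e)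
    (he : Γ.dir e = 0 ∨ Γ.dir e = 2) :
    ∃ q ∈ Γ.seg d, Γ.bottom e.fst ≤ q.2 ∧ q.2 ≤ Γ.top e.fst := by
  obtain ⟨q, ⟨hd, hq⟩, -⟩ := h
  refine ⟨q, hd, ?_⟩
  have hb := Γ.mem_box.1 (Γ.port_mem_box e)
  have hs := Γ.mem_seg.1 hq
  rcases he with he | he
  · have := Γ.of_dir_zero he
    omega
  · have := Γ.of_dir_two he
    omega

/-- A vertical segment that is crossed by a horizontal segment of a lower vertex goes down. -/
theorem Crosses.dir_eq_three {d e : G.Dart} (h : Γ.Crosses d e)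
    (he : Γ.dir e = 0 ∨ Γ.dir e = 2) (hd : Γ.dir d = 1 ∨ Γ.dir d = 3)
    (hlt : Γ.top e.fst < Γ.bottom d.fst) : Γ.dir d = 3 := by
  obtain ⟨q, hq, hq'⟩ := h.exists_mem_rows he
  have hb := Γ.mem_box.1 (Γ.port_mem_box d)
  have hs := Γ.mem_seg.1 hq
  refine hd.resolve_left fun h1 => ?_
  have := Γ.of_dir_one h1
  omega

/-- A vertical segment that is crossed by a horizontal segment of a higher vertex goes up. -/
theorem Crosses.dir_eq_one {d e : G.Dart} (h : Γ.Crosses d e)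
    (he : Γ.dir e = 0 ∨ Γ.dir e = 2) (hd : Γ.dir d = 1 ∨ Γ.dir d = 3)
    (hlt : Γ.top d.fst < Γ.bottom e.fst) : Γ.dir d = 1 := by
  obtain ⟨q, hq, hq'⟩ := h.exists_mem_rows he
  have hb := Γ.mem_box.1 (Γ.port_mem_box d)
  have hs := Γ.mem_seg.1 hq
  refine hd.resolve_right fun h1 => ?_
  have := Γ.of_dir_three h1
  omega

theorem top_lt_bottom_of_dir_eq_one {d : G.Dart} (h : Γ.dir d = 1) :
    Γ.top d.fst < Γ.bottom d.snd := by
  have h1 := Γ.port_one h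
  have h2 := Γ.port_three (d := d.symm) (by rw [Γ.dir_symm, h]; rfl)
  have h3 := Γ.of_dir_one h
  have h4 : d.symm.fst = d.snd := rfl
  rw [h4] at h2
  omega

theorem top_lt_bottom_of_dir_eq_three {d : G.Dart} (h : Γ.dir d = 3) :
    Γ.top d.snd < Γ.bottom d.fst :=
  top_lt_bottom_of_dir_eq_one (d := d.symm) (by rw [Γ.dir_symm, h]; rfl)

/-- Let `l`, `m`, `r` leave `u` and `r'`, `m.symm`, `l'` leave the other end `v` of `m`, such that
`r` crosses `l'` and `r'` crosses `l`. If `l`, `m`, `r` are vertical, then they leave `u` in the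
same direction, and the crossing edges at `v` leave `v` on both sides. -/
theorem EmbeddingPreserving.link (hΓ : Γ.EmbeddingPreserving E) {l m r l' r' : G.Dart}
    (hl : l.fst = m.fst) (hr : r.fst = m.fst) (hl' : l'.fst = m.snd) (hr' : r'.fst = m.snd)
    (hc : E.cross r = l') (hne : l' ≠ r) (hc' : E.cross r' = l) (hne' : l ≠ r')
    (vl : Γ.dir l = 1 ∨ Γ.dir l = 3) (vm : Γ.dir m = 1 ∨ Γ.dir m = 3)
    (vr : Γ.dir r = 1 ∨ Γ.dir r = 3) :
    Γ.dir l = Γ.dir m ∧ Γ.dir r = Γ.dir m ∧ Γ.dir l' = Γ.dir m + 1 ∧ Γ.dir m = Γ.dir r' + 1 := by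
  obtain ⟨hx, hd⟩ := (hΓ.cross r l').1 ⟨hne, hc⟩
  obtain ⟨hx', hd'⟩ := (hΓ.cross r' l).1 ⟨hne', hc'⟩
  have hx'' : Γ.Crosses l r' := by
    obtain ⟨q, ⟨h1, h2⟩, h3, h4, h5, h6⟩ := hx'
    exact ⟨q, ⟨h2, h1⟩, h5, h6, h3, h4⟩
  have wl' : Γ.dir l' = 0 ∨ Γ.dir l' = 2 := by
    rcases vr with h | h <;> rw [hd, h] <;> decide
  have wr' : Γ.dir r' = 0 ∨ Γ.dir r' = 2 := by
    generalize Γ.dir r' = ρ at *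
    rcases vl with h | h <;> rw [h] at hd' <;> clear * - hd' <;> revert ρ <;> decide
  have hlr : Γ.dir l = Γ.dir m ∧ Γ.dir r = Γ.dir m := by
    rcases vm with h | h
    · have hlt := top_lt_bottom_of_dir_eq_one h
      rw [h]
      exact ⟨hx''.dir_eq_one wr' vl (by rwa [hl, hr']), hx.dir_eq_one wl' vr (by rwa [hr, hl'])⟩
    · have hlt := top_lt_bottom_of_dir_eq_three h
      rw [h]
      exact ⟨hx''.dir_eq_three wr' vl (by rwa [hl, hr']),
        hx.dir_eq_three wl' vr (by rwa [hr, hl'])⟩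
  exact ⟨hlr.1, hlr.2, by rw [hd, hlr.2], by rw [← hlr.1, hd']⟩

/-! ### Rotating a representation by a quarter turn -/

/-- The counterclockwise quarter turn of the grid. -/
def turn (q : ℤ × ℤ) : ℤ × ℤ := (-q.2, q.1)

theorem turn_injective : Function.Injective turn := by
  rintro ⟨a, b⟩ ⟨c, d⟩ h
  simp only [turn, Prod.mk.injEq, neg_inj] at h
  exact Prod.ext h.2 h.1

theorem image_turn_uIcc (p q : ℤ × ℤ) :
    turn '' Set.uIcc p q = Set.uIcc (turn p) (turn q) := by
  ext z
  simp only [Set.uIcc, Set.mem_image, Set.mem_Icc, Prod.le_def, Prod.fst_inf, Prod.snd_inf,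
    Prod.fst_sup, Prod.snd_sup, turn]
  constructor
  · rintro ⟨w, h, rfl⟩
    simp only
    omega
  · intro h
    exact ⟨(z.2, -z.1), by simp only; omega, by simp⟩

theorem image_turn_Icc (a b c d : ℤ) :
    turn '' Set.Icc (a, b) (c, d) = Set.Icc (-d, a) (-b, c) := by
  ext z
  simp only [Set.mem_image, Set.mem_Icc, Prod.le_def, turn]
  constructor
  · rintro ⟨w, h, rfl⟩
    simp only
    omega
  · intro h
    exact ⟨(z.2, -z.1), by simp only; omega, by simp⟩

/-- The representation `Γ` after a counterclockwise quarter turn. -/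
def rotate (Γ : VisibilityRep G) : VisibilityRep G where
  left v := -Γ.top v
  right v := -Γ.bottom v
  bottom := Γ.left
  top := Γ.right
  left_le_right v := neg_le_neg (Γ.bottom_le_top v)
  bottom_le_top := Γ.left_le_right
  port d := turn (Γ.port d)
  box_disjoint u v h := by
    rw [← image_turn_Icc, ← image_turn_Icc, Set.disjoint_image_iff turn_injective]
    exact Γ.box_disjoint u v h
  aligned d := by
    have := Γ.aligned d
    simp only [turn]
    omega
  seg_inter_box d := by
    rw [← image_turn_Icc, ← image_turn_uIcc, ← Set.image_inter turn_injective, Γ.seg_inter_box,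
      Set.image_singleton]
  seg_disjoint_box d w h h' := by
    rw [← image_turn_Icc, ← image_turn_uIcc, Set.disjoint_image_iff turn_injective]
    exact Γ.seg_disjoint_box d w h h'

theorem port_rotate (d : G.Dart) : Γ.rotate.port d = turn (Γ.port d) := rfl

theorem seg_rotate (d : G.Dart) : Γ.rotate.seg d = turn '' Γ.seg d := (image_turn_uIcc _ _).symm

theorem box_rotate (v : V) : Γ.rotate.box v = turn '' Γ.box v := (image_turn_Icc _ _ _ _).symm

theorem support_rotate : Γ.rotate.support = turn '' Γ.support := by
  simp only [support, seg_rotate, box_rotate, Set.image_union, Set.image_iUnion]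

theorem mem_support_rotate {q : ℤ × ℤ} : turn q ∈ Γ.rotate.support ↔ q ∈ Γ.support := by
  rw [support_rotate, turn_injective.mem_set_image]

theorem height_rotate : Γ.rotate.height = Γ.width := by
  unfold height width
  congr 1
  ext y
  constructor
  · rintro ⟨x, h⟩
    exact ⟨-x, mem_support_rotate.1 (by simpa [turn] using h)⟩
  · rintro ⟨x, h⟩
    exact ⟨-x, mem_support_rotate.2 h⟩

theorem dir_rotate (d : G.Dart) : Γ.rotate.dir d = Γ.dir d + 1 := by
  have h := Γ.rotate.dir_cases d
  simp only [port_rotate, turn] at h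
  rcases Γ.dir_cases d with ⟨h', p, q⟩ | ⟨h', p, q⟩ | ⟨h', p, q⟩ | ⟨h', p, q⟩ <;>
    rcases h with ⟨k', r, s⟩ | ⟨k', r, s⟩ | ⟨k', r, s⟩ | ⟨k', r, s⟩ <;>
    omega

theorem offset_rotate (d : G.Dart) : Γ.rotate.offset d = Γ.offset d := by
  unfold offset
  rw [dir_rotate]
  generalize Γ.dir d = δ
  fin_cases δ <;> simp [port_rotate, turn]

/-- The quarter turn moves the starting point of the walk around a box, but `Between` depends only
on the cyclic order. -/
theorem between_rotate {d f e : G.Dart} : Γ.rotate.Between d f e ↔ Γ.Between d f e := by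
  unfold Between place
  simp only [dir_rotate, offset_rotate, Prod.Lex.toLex_lt_toLex]
  generalize Γ.dir d = a
  generalize Γ.dir e = b
  generalize Γ.dir f = c
  fin_cases a <;> fin_cases b <;> fin_cases c <;> simp

theorem crosses_rotate {d e : G.Dart} : Γ.rotate.Crosses d e ↔ Γ.Crosses d e := by
  unfold Crosses
  simp only [port_rotate, seg_rotate, ← Set.image_inter turn_injective, Set.exists_mem_image,
    turn_injective.ne_iff]

theorem EmbeddingPreserving.rotate (hΓ : Γ.EmbeddingPreserving E) :
    Γ.rotate.EmbeddingPreserving E where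
  rot d f h := by
    rw [between_rotate]
    exact hΓ.rot d f h
  cross d e := by
    rw [hΓ.cross, crosses_rotate, dir_rotate, dir_rotate, add_left_inj]

end VisibilityRep

/-! ### Cycles of permutations -/

/-- Induction along a cycle, for equivalence relations. -/
theorem Equiv.Perm.SameCycle.rel {α : Type*} {f : Equiv.Perm α} {r : α → α → Prop}
    (hr : Equivalence r) (h : ∀ a, r a (f a)) {a b : α} (hab : f.SameCycle a b) : r a b := by
  obtain ⟨i, rfl⟩ := hab
  induction i using Int.induction_on with
  | zero => exact hr.refl a
  | succ n ih =>
    rw [add_comm, zpow_one_add, Equiv.Perm.mul_apply]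
    exact hr.trans ih (h _)
  | pred n ih =>
    have h1 := h ((f ^ (-(n : ℤ) - 1)) a)
    rw [← Equiv.Perm.mul_apply, ← zpow_one_add, add_sub_cancel] at h1
    exact hr.trans ih (hr.symm h1)

theorem Equiv.Perm.SameCycle.step {α : Type*} {f : Equiv.Perm α} {a b : α} (h : f a = b) :
    f.SameCycle a b := ⟨1, by simpa using h⟩

theorem Equiv.Perm.SameCycle.eq_of_invariant {α β : Type*} {f : Equiv.Perm α} {φ : α → β}
    (h : ∀ a, φ (f a) = φ a) {a b : α} (hab : f.SameCycle a b) : φ a = φ b :=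
  hab.rel (r := fun a b => φ a = φ b) ⟨fun _ => Eq.refl _, Eq.symm, Eq.trans⟩ fun a => (h a).symm

namespace OnePlaneEmbedding

/-- The number of cycles is the number of values of a complete invariant of the cycles. -/
theorem numCycles_eq_card {α β : Type*} (f : Equiv.Perm α) (φ : α → β)
    (hs : Function.Surjective φ) (h : ∀ a b, f.SameCycle a b ↔ φ a = φ b) :
    numCycles f = Nat.card β := by
  refine Nat.card_eq_of_bijective
    (Quotient.lift φ fun a b hab => (h a b).1 hab) ⟨?_, ?_⟩
  · rintro ⟨a⟩ ⟨b⟩ hab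
    exact Quotient.sound ((h a b).2 hab)
  · intro b
    obtain ⟨a, rfl⟩ := hs b
    exact ⟨⟦a⟧, rfl⟩

/-- A fixed-point-free involution consists of transpositions. -/
theorem two_mul_numCycles {α : Type*} (f : Equiv.Perm α) (hf : ∀ a, f (f a) = a)
    (hne : ∀ a, f a ≠ a) : 2 * numCycles f = Nat.card α := by
  have hsc : ∀ {a b}, f.SameCycle a b → b = a ∨ b = f a := fun hab =>
    hab.rel (r := fun a b => b = a ∨ b = f a)
      ⟨fun a => Or.inl rfl, by rintro a b (rfl | rfl) <;> simp [hf],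
        by rintro a b c (rfl | rfl) (rfl | rfl) <;> simp [hf]⟩
      fun a => Or.inr rfl
  let Q := Quotient (Equiv.Perm.SameCycle.setoid f)
  let F : Bool × Q → α := fun p => if p.1 then p.2.out else f p.2.out
  have hF : ∀ p, (⟦F p⟧ : Q) = p.2 := by
    rintro ⟨_ | _, q⟩
    · refine (Quotient.sound ?_).trans q.out_eq
      exact (Equiv.Perm.SameCycle.step rfl).symm
    · exact q.out_eq
  have hbij : Function.Bijective F := by
    constructor
    · intro p p' h
      have hq : p.2 = p'.2 := by rw [← hF p, ← hF p', h]
      obtain ⟨b, q⟩ := p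
      obtain ⟨b', q'⟩ := p'
      obtain rfl : q = q' := hq
      have h1 := hne q.out
      cases b <;> cases b'
      · rfl
      · exact absurd h h1
      · exact absurd h.symm h1
      · rfl
    · intro a
      have h1 : f.SameCycle (⟦a⟧ : Q).out a := Quotient.exact (s := Equiv.Perm.SameCycle.setoid f)
        (Quotient.out_eq _)
      rcases hsc h1 with h2 | h2
      · exact ⟨(true, ⟦a⟧), h2.symm⟩
      · exact ⟨(false, ⟦a⟧), h2.symm⟩
  rw [← Nat.card_eq_of_bijective F hbij, Nat.card_prod]
  simp [numCycles, Q]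

end OnePlaneEmbedding

/-! ### Crossed links -/

/-- The skeleton of the graphs considered below: a plane graph with vertex set `B`, given as a
combinatorial map on the set `X` of its darts (called *ends*). An edge of the skeleton is called a
*link*, and the end `x` belongs to the vertex `vert x`; `next` is the counterclockwise rotation
around the vertices and `mate` exchanges the two ends of a link. In the angle between the ends `x`
and `next x`, there will be `extra x + 1` plain leaves besides the two crossed ones. -/
structure LinkMap (B X : Type) where
  vert : X → B
  next : Equiv.Perm X
  mate : X → X
  extra : X → ℕ
  mate_mate : ∀ x, mate (mate x) = x
  next_sameCycle : ∀ x y, next.SameCycle x y ↔ vert x = vert y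
  vert_mate_ne : ∀ x, vert (mate x) ≠ vert x
  eq_of_vert_eq : ∀ x y, vert x = vert y → vert (mate x) = vert (mate y) → x = y

namespace LinkMap

variable {B X : Type} (L : LinkMap B X)

/-- The leaves that are attached to the skeleton: the counterclockwise order at `vert x` is
`left x`, the link of `x`, `right x`, `plain x 0`, `plain x 1`, ..., and then `left (next x)`. -/
inductive Twig : Type
  | left (x : X)
  | right (x : X)
  | plain (x : X) (i : Fin (L.extra x + 1))

/-- The darts of the graph: the ends of the links, and every leaf edge in its two directions,
towards the leaf (`out`) and from the leaf to the skeleton (`inn`). -/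
inductive Slot : Type
  | link (x : X)
  | out (t : L.Twig)
  | inn (t : L.Twig)

/-- The end next to which a leaf is attached. -/
def Twig.base {L : LinkMap B X} : L.Twig → X
  | .left x => x
  | .right x => x
  | .plain x _ => x

/-- The vertices of the graph: those of the skeleton and the leaves. -/
abbrev Vertex : Type := B ⊕ L.Twig

/-- The vertex that a dart leaves. -/
def Slot.tail {L : LinkMap B X} : L.Slot → L.Vertex
  | .link x => .inl (L.vert x)
  | .out t => .inl (L.vert t.base)
  | .inn t => .inr t

/-- The reversed dart. -/
def Slot.rev {L : LinkMap B X} : L.Slot → L.Slot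
  | .link x => .link (L.mate x)
  | .out t => .inn t
  | .inn t => .out t

theorem Slot.rev_rev {L : LinkMap B X} (s : L.Slot) : s.rev.rev = s := by
  cases s <;> simp [Slot.rev, L.mate_mate]

/-- The skeleton with its leaves. -/
def graph : SimpleGraph L.Vertex where
  Adj v w := ∃ s : L.Slot, s.tail = v ∧ s.rev.tail = w
  symm := ⟨by
    rintro v w ⟨s, h, h'⟩
    exact ⟨s.rev, h', by rw [s.rev_rev, h]⟩⟩
  loopless := ⟨by
    rintro v ⟨s | s | s, rfl, h⟩
    · exact L.vert_mate_ne s (Sum.inl_injective h)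
    · exact absurd h (by simp [Slot.tail, Slot.rev])
    · exact absurd h (by simp [Slot.tail, Slot.rev])⟩

def toDart (s : L.Slot) : L.graph.Dart := ⟨(s.tail, s.rev.tail), s, rfl, rfl⟩

theorem toDart_bijective : Function.Bijective L.toDart := by
  constructor
  · intro s t h
    have h1 : s.tail = t.tail := congrArg (fun d => d.fst) h
    have h2 : s.rev.tail = t.rev.tail := congrArg (fun d => d.snd) h
    cases s <;> cases t <;> simp_all [Slot.tail, Slot.rev]
    exact L.eq_of_vert_eq _ _ h1 h2
  · rintro ⟨⟨v, w⟩, s, hv, hw⟩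
    exact ⟨s, SimpleGraph.Dart.ext _ _ (Prod.ext hv hw)⟩

/-- The slots are the darts of the graph; the skeleton has neither loops nor parallel links, so a
dart determines its slot. -/
noncomputable def slotEquiv : L.Slot ≃ L.graph.Dart := Equiv.ofBijective _ L.toDart_bijective

@[simp] theorem slotEquiv_fst (s : L.Slot) : (L.slotEquiv s).fst = s.tail := rfl

theorem slotEquiv_symm (s : L.Slot) : (L.slotEquiv s).symm = L.slotEquiv s.rev := by
  refine SimpleGraph.Dart.ext _ _ (Prod.ext rfl ?_)
  change s.tail = s.rev.rev.tail
  rw [s.rev_rev]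

/-- The counterclockwise rotation around the vertices. -/
def rot : Equiv.Perm L.Slot where
  toFun
    | .link x => .out (.right x)
    | .out (.left x) => .link x
    | .out (.right x) => .out (.plain x 0)
    | .out (.plain x i) => Fin.lastCases (motive := fun _ => L.Slot) (.out (.left (L.next x)))
        (fun j => .out (.plain x j.succ)) i
    | .inn t => .inn t
  invFun
    | .link x => .out (.left x)
    | .out (.right x) => .link x
    | .out (.left x) => .out (.plain (L.next.symm x) (Fin.last _))
    | .out (.plain x i) => Fin.cases (motive := fun _ => L.Slot) (.out (.right x))
        (fun j => .out (.plain x j.castSucc)) i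
    | .inn t => .inn t
  left_inv := by
    rintro (x | (x | x | ⟨x, i⟩) | t) <;> try rfl
    induction i using Fin.lastCases with
    | last =>
      have h : ∀ y, y = x → (Slot.out (.plain y (Fin.last _)) : L.Slot) =
          .out (.plain x (Fin.last _)) := by
        rintro _ rfl
        rfl
      simpa only [Fin.lastCases_last] using h _ (L.next.symm_apply_apply x)
    | cast j => simp
  right_inv := by
    rintro (x | (x | x | ⟨x, i⟩) | t) <;> try rfl
    · simp
    · induction i using Fin.cases <;> simp

theorem rot_link (x : X) : L.rot (.link x) = .out (.right x) := rfl
theorem rot_left (x : X) : L.rot (.out (.left x)) = .link x := rfl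
theorem rot_right (x : X) : L.rot (.out (.right x)) = .out (.plain x 0) := rfl

theorem rot_last (x : X) :
    L.rot (.out (.plain x (Fin.last _))) = .out (.left (L.next x)) := by
  simp [rot]

theorem rot_castSucc (x : X) (i : Fin (L.extra x)) :
    L.rot (.out (.plain x i.castSucc)) = .out (.plain x i.succ) := by
  simp [rot]

/-- On both sides of a link, the two leaf edges that are next to it cross each other. -/
def cross : Equiv.Perm L.Slot where
  toFun
    | .out (.right x) => .out (.left (L.mate x))
    | .out (.left x) => .inn (.right (L.mate x))
    | .inn (.right x) => .inn (.left (L.mate x))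
    | .inn (.left x) => .out (.right (L.mate x))
    | s => s
  invFun
    | .out (.right x) => .inn (.left (L.mate x))
    | .out (.left x) => .out (.right (L.mate x))
    | .inn (.right x) => .out (.left (L.mate x))
    | .inn (.left x) => .inn (.right (L.mate x))
    | s => s
  left_inv := by
    rintro (x | (x | x | ⟨x, i⟩) | (x | x | ⟨x, i⟩)) <;> simp [L.mate_mate]
  right_inv := by
    rintro (x | (x | x | ⟨x, i⟩) | (x | x | ⟨x, i⟩)) <;> simp [L.mate_mate]

theorem cross_link (x : X) : L.cross (.link x) = .link x := rfl
theorem cross_out_right (x : X) : L.cross (.out (.right x)) = .out (.left (L.mate x)) := rfl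
theorem cross_inn_right (x : X) : L.cross (.inn (.right x)) = .inn (.left (L.mate x)) := rfl
theorem cross_inn_left (x : X) : L.cross (.inn (.left x)) = .out (.right (L.mate x)) := rfl
theorem cross_out_plain (x : X) (i) : L.cross (.out (.plain x i)) = .out (.plain x i) := rfl
theorem cross_inn_plain (x : X) (i) : L.cross (.inn (.plain x i)) = .inn (.plain x i) := rfl

theorem cross_cross (s : L.Slot) (h : L.cross s ≠ s) : L.cross (L.cross s) = s.rev := by
  rcases s with x | (x | x | ⟨x, i⟩) | (x | x | ⟨x, i⟩) <;>
    first
    | exact absurd rfl h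
    | simp [cross, Slot.rev, L.mate_mate]

theorem cross_tail_ne (s : L.Slot) (h : L.cross s ≠ s) : (L.cross s).tail ≠ s.tail := by
  rcases s with x | (x | x | ⟨x, i⟩) | (x | x | ⟨x, i⟩) <;>
    first
    | exact absurd rfl h
    | simp [cross, Slot.tail, Twig.base, L.vert_mate_ne]

theorem rot_tail (s : L.Slot) : (L.rot s).tail = s.tail := by
  rcases s with x | (x | x | ⟨x, i⟩) | t <;> try rfl
  induction i using Fin.lastCases with
  | last =>
    rw [rot_last]
    exact congrArg Sum.inl ((L.next_sameCycle _ _).1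
      (Equiv.Perm.sameCycle_apply_left.2 (.refl _ _)))
  | cast j =>
    rw [rot_castSucc]
    rfl

theorem sameCycle_left_plain (x : X) (i : Fin (L.extra x + 1)) :
    L.rot.SameCycle (.out (.left x)) (.out (.plain x i)) := by
  induction i using Fin.induction with
  | zero =>
    exact ((Equiv.Perm.SameCycle.step (L.rot_left x)).trans (.step (L.rot_link x))).trans
      (.step (L.rot_right x))
  | succ j ih => exact ih.trans (.step (L.rot_castSucc x j))

theorem sameCycle_left_left {x y : X} (h : L.vert x = L.vert y) :
    L.rot.SameCycle (.out (.left x)) (.out (.left y)) :=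
  ((L.next_sameCycle x y).2 h).rel
    (r := fun x y => L.rot.SameCycle (.out (.left x)) (.out (.left y)))
    ⟨fun _ => .refl _ _, .symm, .trans⟩
    fun x => (L.sameCycle_left_plain x (Fin.last _)).trans (.step (L.rot_last x))

theorem rot_sameCycle (s t : L.Slot) : L.rot.SameCycle s t ↔ s.tail = t.tail := by
  refine ⟨fun h => h.eq_of_invariant L.rot_tail, fun h => ?_⟩
  have key : ∀ s : L.Slot, (∃ x, s.tail = .inl (L.vert x) ∧
      L.rot.SameCycle (.out (.left x)) s) ∨ ∃ t, s = .inn t := by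
    rintro (x | (x | x | ⟨x, i⟩) | t)
    · exact Or.inl ⟨x, rfl, .step (L.rot_left x)⟩
    · exact Or.inl ⟨x, rfl, .refl _ _⟩
    · exact Or.inl ⟨x, rfl, (Equiv.Perm.SameCycle.step (L.rot_left x)).trans
        (.step (L.rot_link x))⟩
    · exact Or.inl ⟨x, rfl, L.sameCycle_left_plain x i⟩
    · exact Or.inr ⟨t, rfl⟩
  rcases key s with ⟨x, hx, hs⟩ | ⟨u, rfl⟩ <;> rcases key t with ⟨y, hy, ht⟩ | ⟨w, rfl⟩
  · rw [hx, hy] at h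
    exact (hs.symm.trans (L.sameCycle_left_left (Sum.inl_injective h))).trans ht
  · rw [hx] at h
    exact absurd h (by simp [Slot.tail])
  · rw [hy] at h
    exact absurd h (by simp [Slot.tail])
  · obtain rfl : u = w := Sum.inr_injective h
    exact .refl _ _

/-- The skeleton with its leaves, embedded such that on both sides of every link the two
neighbouring leaf edges cross. -/
noncomputable def embedding : OnePlaneEmbedding L.graph where
  rot := L.slotEquiv.permCongr L.rot
  cross := L.slotEquiv.permCongr L.cross
  rot_sameCycle d e := by
    obtain ⟨s, rfl⟩ := L.slotEquiv.surjective d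
    obtain ⟨t, rfl⟩ := L.slotEquiv.surjective e
    rw [slotEquiv_fst, slotEquiv_fst, ← L.rot_sameCycle]
    constructor
    · intro h
      have := h.rel (r := fun d e => L.rot.SameCycle (L.slotEquiv.symm d) (L.slotEquiv.symm e))
        ⟨fun _ => .refl _ _, .symm, .trans⟩ fun d => .step (by simp [Equiv.permCongr_apply])
      simpa using this
    · intro h
      exact h.rel (r := fun s t =>
        Equiv.Perm.SameCycle (L.slotEquiv.permCongr L.rot) (L.slotEquiv s) (L.slotEquiv t))
        ⟨fun _ => .refl _ _, .symm, .trans⟩ fun d => .step (by simp [Equiv.permCongr_apply])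
  cross_cross d h := by
    obtain ⟨s, rfl⟩ := L.slotEquiv.surjective d
    simp only [Equiv.permCongr_apply, Equiv.symm_apply_apply, slotEquiv_symm, ne_eq,
      EmbeddingLike.apply_eq_iff_eq] at h ⊢
    exact L.cross_cross s h
  cross_fst_ne d h := by
    obtain ⟨s, rfl⟩ := L.slotEquiv.surjective d
    simp only [Equiv.permCongr_apply, Equiv.symm_apply_apply, ne_eq,
      EmbeddingLike.apply_eq_iff_eq] at h ⊢
    exact L.cross_tail_ne s h

theorem embedding_rot (s : L.Slot) : L.embedding.rot (L.slotEquiv s) = L.slotEquiv (L.rot s) := by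
  simp [embedding, Equiv.permCongr_apply]

theorem embedding_cross (s : L.Slot) :
    L.embedding.cross (L.slotEquiv s) = L.slotEquiv (L.cross s) := by
  simp [embedding, Equiv.permCongr_apply]

end LinkMap

namespace LinkMap

variable {B X : Type} (L : LinkMap B X)

/-! ### The planarization -/

/-- The dart of the planarization that leaves the tail of `s` along the edge of `s`. -/
noncomputable def edgeDart (s : L.Slot) : L.embedding.PlanDart :=
  L.embedding.ofDart (L.slotEquiv s)

/-- The dart of the planarization that leaves the crossing point on the edge of `s` towards the
tail of `s`. -/
noncomputable def crossDart (s : L.Slot) (h : L.cross s ≠ s) : L.embedding.PlanDart :=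
  ⟨(L.slotEquiv s, true), fun _ => by simpa [embedding_cross] using h⟩

theorem crossDart_congr {s t : L.Slot} (h : L.cross s ≠ s) (h' : L.cross t ≠ t) (hst : s = t) :
    L.crossDart s h = L.crossDart t h' := by
  subst hst
  rfl

theorem planRev_edgeDart {s : L.Slot} (h : L.cross s = s) :
    L.embedding.planRev (L.edgeDart s) = L.edgeDart s.rev := by
  have h' : L.embedding.cross (L.slotEquiv s) = L.slotEquiv s := by rw [embedding_cross, h]
  refine Subtype.ext (Prod.ext ?_ ?_) <;>
    simp [OnePlaneEmbedding.planRev, OnePlaneEmbedding.planRevFun, edgeDart,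
      OnePlaneEmbedding.ofDart, h', slotEquiv_symm]

theorem planRev_edgeDart_of_ne {s : L.Slot} (h : L.cross s ≠ s) :
    L.embedding.planRev (L.edgeDart s) = L.crossDart s h := by
  have h' : L.embedding.cross (L.slotEquiv s) ≠ L.slotEquiv s := by simpa [embedding_cross] using h
  refine Subtype.ext (Prod.ext ?_ ?_) <;>
    simp [OnePlaneEmbedding.planRev, OnePlaneEmbedding.planRevFun, edgeDart, crossDart,
      OnePlaneEmbedding.ofDart, h']

theorem planRev_crossDart {s : L.Slot} (h : L.cross s ≠ s) :
    L.embedding.planRev (L.crossDart s h) = L.edgeDart s := by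
  have h' : L.embedding.cross (L.slotEquiv s) ≠ L.slotEquiv s := by simpa [embedding_cross] using h
  refine Subtype.ext (Prod.ext ?_ ?_) <;>
    simp [OnePlaneEmbedding.planRev, OnePlaneEmbedding.planRevFun, edgeDart, crossDart,
      OnePlaneEmbedding.ofDart, h']

theorem planRot_edgeDart (s : L.Slot) :
    L.embedding.planRot (L.edgeDart s) = L.edgeDart (L.rot s) :=
  Subtype.ext (Prod.ext (L.embedding_rot s) rfl)

theorem cross_cross_ne {s : L.Slot} (h : L.cross s ≠ s) : L.cross (L.cross s) ≠ L.cross s :=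
  fun h' => h (L.cross.injective h')

theorem planRot_crossDart {s : L.Slot} (h : L.cross s ≠ s) :
    L.embedding.planRot (L.crossDart s h) = L.crossDart (L.cross s) (L.cross_cross_ne h) :=
  Subtype.ext (Prod.ext (L.embedding_cross s) rfl)

theorem planFace_edgeDart {s : L.Slot} (h : L.cross s = s) :
    L.embedding.planFace (L.edgeDart s) = L.edgeDart (L.rot s.rev) := by
  rw [OnePlaneEmbedding.planFace, Equiv.trans_apply, planRev_edgeDart _ h, planRot_edgeDart]

theorem planFace_edgeDart_of_ne {s : L.Slot} (h : L.cross s ≠ s) :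
    L.embedding.planFace (L.edgeDart s) = L.crossDart (L.cross s) (L.cross_cross_ne h) := by
  rw [OnePlaneEmbedding.planFace, Equiv.trans_apply, planRev_edgeDart_of_ne _ h,
    planRot_crossDart]

theorem planFace_crossDart {s : L.Slot} (h : L.cross s ≠ s) :
    L.embedding.planFace (L.crossDart s h) = L.edgeDart (L.rot s) := by
  rw [OnePlaneEmbedding.planFace, Equiv.trans_apply, planRev_crossDart _ h, planRot_edgeDart]

theorem planDart_cases (p : L.embedding.PlanDart) :
    (∃ s, p = L.edgeDart s) ∨ ∃ s h, p = L.crossDart s h := by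
  obtain ⟨⟨d, b⟩, hp⟩ := p
  obtain ⟨s, rfl⟩ := L.slotEquiv.surjective d
  cases b
  · exact Or.inl ⟨s, rfl⟩
  · exact Or.inr ⟨s, by simpa [embedding_cross] using hp, rfl⟩

/-- The slot of a crossed edge: leaf edge to the right or left of `x`, in one of two directions. -/
def crossedSlot : X × Bool × Bool → L.Slot
  | (x, true, true) => .out (.right x)
  | (x, false, true) => .out (.left x)
  | (x, true, false) => .inn (.right x)
  | (x, false, false) => .inn (.left x)

theorem cross_crossedSlot_ne (c : X × Bool × Bool) :
    L.cross (L.crossedSlot c) ≠ L.crossedSlot c := by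
  obtain ⟨x, _ | _, _ | _⟩ := c <;> simp [crossedSlot, cross]

theorem exists_crossedSlot {s : L.Slot} (h : L.cross s ≠ s) : ∃ c, s = L.crossedSlot c := by
  rcases s with x | (x | x | ⟨x, i⟩) | (x | x | ⟨x, i⟩)
  · exact absurd rfl h
  · exact ⟨(x, false, true), rfl⟩
  · exact ⟨(x, true, true), rfl⟩
  · exact absurd rfl h
  · exact ⟨(x, false, false), rfl⟩
  · exact ⟨(x, true, false), rfl⟩
  · exact absurd rfl h

theorem crossedSlot_injective : Function.Injective L.crossedSlot := by
  rintro ⟨x, _ | _, _ | _⟩ ⟨y, _ | _, _ | _⟩ h <;> simp_all [crossedSlot]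

def twigEquiv : L.Twig ≃ (X ⊕ X) ⊕ Σ x, Fin (L.extra x + 1) where
  toFun
    | .left x => .inl (.inl x)
    | .right x => .inl (.inr x)
    | .plain x i => .inr ⟨x, i⟩
  invFun
    | .inl (.inl x) => .left x
    | .inl (.inr x) => .right x
    | .inr ⟨x, i⟩ => .plain x i
  left_inv := by rintro (_ | _ | _) <;> rfl
  right_inv := by rintro ((_ | _) | _) <;> rfl

def slotEquivSum : L.Slot ≃ X ⊕ (L.Twig ⊕ L.Twig) where
  toFun
    | .link x => .inl x
    | .out t => .inr (.inl t)
    | .inn t => .inr (.inr t)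
  invFun
    | .inl x => .link x
    | .inr (.inl t) => .out t
    | .inr (.inr t) => .inn t
  left_inv := by rintro (_ | _ | _) <;> rfl
  right_inv := by rintro (_ | _ | _) <;> rfl

instance [Finite X] : Finite L.Twig := Finite.of_equiv _ L.twigEquiv.symm

instance [Finite X] : Finite L.Slot := Finite.of_equiv _ L.slotEquivSum.symm

theorem card_planDart [Finite X] :
    Nat.card L.embedding.PlanDart = Nat.card L.Slot + Nat.card (X × Bool × Bool) := by
  rw [← Nat.card_sum]
  symm
  refine Nat.card_eq_of_bijective
    (Sum.elim L.edgeDart fun c => L.crossDart (L.crossedSlot c) (L.cross_crossedSlot_ne c))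
    ⟨?_, ?_⟩
  · rintro (s | c) (t | c') h <;>
      have h1 := congrArg (fun p => L.slotEquiv.symm p.1.1) h <;>
      have h2 := congrArg (fun p => p.1.2) h <;>
      simp only [Sum.elim_inl, Sum.elim_inr, edgeDart, crossDart, OnePlaneEmbedding.ofDart,
        Equiv.symm_apply_apply] at h1 h2
    · rw [h1]
    · exact absurd h2 (by simp)
    · exact absurd h2 (by simp)
    · rw [L.crossedSlot_injective h1]
  · intro p
    rcases L.planDart_cases p with ⟨s, rfl⟩ | ⟨s, h, rfl⟩
    · exact ⟨.inl s, rfl⟩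
    · obtain ⟨c, rfl⟩ := L.exists_crossedSlot h
      exact ⟨.inr c, rfl⟩

/-- A function on the darts of the planarization, given by its values at the darts that leave a
vertex (`false`) and at those that leave a crossing point (`true`). -/
noncomputable def planMark {β : Type} (f : L.Slot → Bool → β) (p : L.embedding.PlanDart) : β :=
  f (L.slotEquiv.symm p.1.1) p.1.2

@[simp] theorem planMark_edgeDart {β : Type} (f : L.Slot → Bool → β) (s : L.Slot) :
    L.planMark f (L.edgeDart s) = f s false := by
  simp [planMark, edgeDart, OnePlaneEmbedding.ofDart]

@[simp] theorem planMark_crossDart {β : Type} (f : L.Slot → Bool → β) (s : L.Slot) (h) :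
    L.planMark f (L.crossDart s h) = f s true := by
  simp [planMark, crossDart]

/-- The vertex (`inl`) or the crossing point (`inr`) that a dart of the planarization leaves. The
crossing point of the edges of `right x` and `left (mate x)` is named by `x`. -/
def origin : L.Slot → Bool → L.Vertex ⊕ X
  | .out (.right x), true => .inr x
  | .inn (.right x), true => .inr x
  | .out (.left x), true => .inr (L.mate x)
  | .inn (.left x), true => .inr (L.mate x)
  | s, _ => .inl s.tail

theorem origin_planRot (p : L.embedding.PlanDart) :
    L.planMark L.origin (L.embedding.planRot p) = L.planMark L.origin p := by
  rcases L.planDart_cases p with ⟨s, rfl⟩ | ⟨s, h, rfl⟩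
  · rw [planRot_edgeDart, planMark_edgeDart, planMark_edgeDart]
    have h : ∀ s : L.Slot, L.origin s false = .inl s.tail := by
      rintro (x | (x | x | ⟨x, i⟩) | (x | x | ⟨x, i⟩)) <;> rfl
    rw [h, h, rot_tail]
  · rw [planRot_crossDart, planMark_crossDart, planMark_crossDart]
    obtain ⟨⟨x, _ | _, _ | _⟩, rfl⟩ := L.exists_crossedSlot h <;>
      simp [crossedSlot, cross, origin, L.mate_mate]

theorem planRot_sameCycle_edgeDart {s t : L.Slot} (h : s.tail = t.tail) :
    L.embedding.planRot.SameCycle (L.edgeDart s) (L.edgeDart t) :=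
  ((L.rot_sameCycle s t).2 h).rel
    (r := fun s t => L.embedding.planRot.SameCycle (L.edgeDart s) (L.edgeDart t))
    ⟨fun _ => .refl _ _, .symm, .trans⟩ fun s => .step (L.planRot_edgeDart s)

theorem planRot_sameCycle_crossDart (s : L.Slot) (h : L.cross s ≠ s) :
    ∃ x, L.planMark L.origin (L.crossDart s h) = .inr x ∧
      L.embedding.planRot.SameCycle (L.crossDart s h)
        (L.crossDart (.out (.right x)) (by simp [cross])) := by
  have key : ∀ x, L.embedding.planRot.SameCycle
      (L.crossDart (.inn (.left (L.mate x))) (by simp [cross]))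
        (L.crossDart (.out (.right x)) (by simp [cross])) := fun x => by
    refine .step ((L.planRot_crossDart _).trans (L.crossDart_congr _ _ ?_))
    rw [cross_inn_left, L.mate_mate]
  have key2 : ∀ x, L.embedding.planRot.SameCycle
      (L.crossDart (.inn (.right x)) (by simp [cross]))
        (L.crossDart (.inn (.left (L.mate x))) (by simp [cross])) := fun x =>
    .step (L.planRot_crossDart _)
  rcases s with x | (x | x | ⟨x, i⟩) | (x | x | ⟨x, i⟩)
  · exact absurd rfl h
  · refine ⟨L.mate x, L.planMark_crossDart _ _ _, ?_⟩
    exact ((Equiv.Perm.SameCycle.step (L.planRot_crossDart _)).trans (key2 (L.mate x))).trans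
      (key (L.mate x))
  · exact ⟨x, L.planMark_crossDart _ _ _, .refl _ _⟩
  · exact absurd rfl h
  · refine ⟨L.mate x, L.planMark_crossDart _ _ _, ?_⟩
    have := key (L.mate x)
    simp only [L.mate_mate] at this
    exact this
  · exact ⟨x, L.planMark_crossDart _ _ _, (key2 x).trans (key x)⟩
  · exact absurd rfl h

theorem numCycles_planRot (hv : Function.Surjective L.vert) :
    OnePlaneEmbedding.numCycles L.embedding.planRot = Nat.card (L.Vertex ⊕ X) := by
  have hE : ∀ s : L.Slot, L.origin s false = .inl s.tail := by
    rintro (x | (x | x | ⟨x, i⟩) | (x | x | ⟨x, i⟩)) <;> rfl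
  refine OnePlaneEmbedding.numCycles_eq_card _ (L.planMark L.origin) ?_ fun p q =>
    ⟨fun h => h.eq_of_invariant L.origin_planRot, fun h => ?_⟩
  · rintro ((b | t) | x)
    · obtain ⟨x, rfl⟩ := hv b
      exact ⟨L.edgeDart (.link x), L.planMark_edgeDart _ _⟩
    · exact ⟨L.edgeDart (.inn t), by rw [planMark_edgeDart, hE]; rfl⟩
    · exact ⟨L.crossDart (.out (.right x)) (by simp [cross]), L.planMark_crossDart _ _ _⟩
  · rcases L.planDart_cases p with ⟨s, rfl⟩ | ⟨s, hs, rfl⟩ <;>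
      rcases L.planDart_cases q with ⟨t, rfl⟩ | ⟨t, ht, rfl⟩
    · rw [planMark_edgeDart, planMark_edgeDart, hE, hE] at h
      exact L.planRot_sameCycle_edgeDart (Sum.inl_injective h)
    · obtain ⟨y, hy, -⟩ := L.planRot_sameCycle_crossDart t ht
      rw [hy, planMark_edgeDart, hE] at h
      exact absurd h (by simp)
    · obtain ⟨y, hy, -⟩ := L.planRot_sameCycle_crossDart s hs
      rw [hy, planMark_edgeDart, hE] at h
      exact absurd h (by simp)
    · obtain ⟨x, hx, hsx⟩ := L.planRot_sameCycle_crossDart s hs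
      obtain ⟨y, hy, hty⟩ := L.planRot_sameCycle_crossDart t ht
      rw [hx, hy] at h
      obtain rfl := Sum.inr_injective h
      exact hsx.trans hty.symm

theorem two_mul_numCycles_planRev [Finite X] :
    2 * OnePlaneEmbedding.numCycles L.embedding.planRev =
      Nat.card L.Slot + Nat.card (X × Bool × Bool) := by
  rw [← card_planDart]
  refine OnePlaneEmbedding.two_mul_numCycles _ L.embedding.planRevFun_involutive fun p h => ?_
  rcases L.planDart_cases p with ⟨s, rfl⟩ | ⟨s, hs, rfl⟩
  · by_cases hs : L.cross s = s
    · rw [planRev_edgeDart _ hs] at h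
      have h1 := congrArg (L.planMark fun s _ => s.tail) h
      simp only [planMark_edgeDart] at h1
      exact (L.toDart s).adj.ne h1.symm
    · rw [planRev_edgeDart_of_ne _ hs] at h
      have h1 := congrArg (L.planMark fun _ b => b) h
      simp at h1
  · rw [planRev_crossDart _ hs] at h
    have h1 := congrArg (L.planMark fun _ b => b) h
    simp at h1

/-! ### The faces -/

/-- The face to which a dart of the planarization belongs: `some x` is the triangle of the link of
`x`, the edge of `left x` and the edge of `right (mate x)`, and `none` is the outer face. -/
def face : L.Slot → Bool → Option X
  | .link x, false => some x
  | .out (.right x), false => some (L.mate x)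
  | .out (.left x), true => some x
  | _, _ => none

theorem face_planFace (p : L.embedding.PlanDart) :
    L.planMark L.face (L.embedding.planFace p) = L.planMark L.face p := by
  rcases L.planDart_cases p with ⟨s, rfl⟩ | ⟨s, h, rfl⟩
  · by_cases h : L.cross s = s
    · rw [planFace_edgeDart _ h, planMark_edgeDart, planMark_edgeDart]
      rcases s with x | (x | x | ⟨x, i⟩) | (x | x | ⟨x, i⟩)
      · simp [Slot.rev, rot_link, face, L.mate_mate]
      · exact absurd h (L.cross_crossedSlot_ne (x, false, true))
      · exact absurd h (L.cross_crossedSlot_ne (x, true, true))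
      · rfl
      · exact absurd h (L.cross_crossedSlot_ne (x, false, false))
      · exact absurd h (L.cross_crossedSlot_ne (x, true, false))
      · change L.face (L.rot (.out (.plain x i))) false = none
        induction i using Fin.lastCases with
        | last => rw [rot_last]; rfl
        | cast j => rw [rot_castSucc]; rfl
    · rw [planFace_edgeDart_of_ne _ h, planMark_crossDart, planMark_edgeDart]
      obtain ⟨⟨x, _ | _, _ | _⟩, rfl⟩ := L.exists_crossedSlot h <;> rfl
  · rw [planFace_crossDart _ h, planMark_edgeDart, planMark_crossDart]
    obtain ⟨⟨x, _ | _, _ | _⟩, rfl⟩ := L.exists_crossedSlot h <;> rfl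

/-- The skeleton has a single face; this is stated as an induction principle for the face
permutation `x ↦ mate (next x)`. -/
def OneFace : Prop :=
  ∀ r : X → X → Prop, Equivalence r → (∀ x, r x (L.mate (L.next x))) → ∀ x y, r x y

/-- Two darts of the planarization are on a common facial circuit. -/
abbrev SameFace (p q : L.embedding.PlanDart) : Prop := L.embedding.planFace.SameCycle p q

theorem sameFace_out_inn_plain (x : X) (i) :
    L.SameFace (L.edgeDart (.out (.plain x i))) (L.edgeDart (.inn (.plain x i))) :=
  .step (L.planFace_edgeDart (L.cross_out_plain x i))

theorem sameFace_inn_plain (x : X) (i) :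
    L.SameFace (L.edgeDart (.inn (.plain x i))) (L.edgeDart (L.rot (.out (.plain x i)))) :=
  .step (L.planFace_edgeDart (L.cross_inn_plain x i))

theorem sameFace_plain (x : X) (i) :
    L.SameFace (L.edgeDart (.out (.plain x 0))) (L.edgeDart (.out (.plain x i))) := by
  induction i using Fin.induction with
  | zero => exact .refl _ _
  | succ j ih =>
    refine ih.trans ((L.sameFace_out_inn_plain x _).trans ?_)
    have := L.sameFace_inn_plain x j.castSucc
    rwa [rot_castSucc] at this

theorem sameFace_plain_left_next (x : X) :
    L.SameFace (L.edgeDart (.out (.plain x 0))) (L.edgeDart (.out (.left (L.next x)))) := by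
  refine (L.sameFace_plain x (Fin.last _)).trans ((L.sameFace_out_inn_plain x _).trans ?_)
  have := L.sameFace_inn_plain x (Fin.last _)
  rwa [rot_last] at this

/-- The part of the outer face that runs around the crossing next to `left x`. -/
theorem sameFace_left (x : X) :
    L.SameFace (L.edgeDart (.out (.left x)))
        (L.crossDart (.inn (.right (L.mate x))) (L.cross_crossedSlot_ne (_, true, false))) ∧
    L.SameFace (L.edgeDart (.out (.left x))) (L.edgeDart (.inn (.right (L.mate x)))) ∧
    L.SameFace (L.edgeDart (.out (.left x)))
      (L.crossDart (.inn (.left x)) (L.cross_crossedSlot_ne (_, false, false))) ∧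
    L.SameFace (L.edgeDart (.out (.left x))) (L.edgeDart (.inn (.left x))) ∧
    L.SameFace (L.edgeDart (.out (.left x)))
      (L.crossDart (.out (.right (L.mate x))) (L.cross_crossedSlot_ne (_, true, true))) ∧
    L.SameFace (L.edgeDart (.out (.left x))) (L.edgeDart (.out (.plain (L.mate x) 0))) := by
  have h1 : L.SameFace (L.edgeDart (.out (.left x)))
      (L.crossDart (.inn (.right (L.mate x))) (L.cross_crossedSlot_ne (_, true, false))) :=
    .step (L.planFace_edgeDart_of_ne (L.cross_crossedSlot_ne (x, false, true)))
  have h2 := h1.trans (.step (L.planFace_crossDart _))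
  have h3 : L.SameFace (L.edgeDart (.inn (.right (L.mate x))))
      (L.crossDart (.inn (.left x)) (L.cross_crossedSlot_ne (_, false, false))) := by
    refine .step ((L.planFace_edgeDart_of_ne
      (L.cross_crossedSlot_ne (L.mate x, true, false))).trans (L.crossDart_congr _ _ ?_))
    rw [crossedSlot, cross_inn_right, L.mate_mate]
  have h3 := h2.trans h3
  have h4 := h3.trans (.step (L.planFace_crossDart _))
  have h5 := h4.trans (.step
    (L.planFace_edgeDart_of_ne (L.cross_crossedSlot_ne (x, false, false))))
  have h6 := h5.trans (.step (L.planFace_crossDart _))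
  exact ⟨h1, h2, h3, h4, h5, h6⟩

theorem sameFace_plain_plain (hL : L.OneFace) (x y : X) :
    L.SameFace (L.edgeDart (.out (.plain x 0))) (L.edgeDart (.out (.plain y 0))) :=
  hL (fun x y => L.SameFace (L.edgeDart (.out (.plain x 0))) (L.edgeDart (.out (.plain y 0))))
    ⟨fun _ => .refl _ _, .symm, .trans⟩
    (fun x => (L.sameFace_plain_left_next x).trans (L.sameFace_left (L.next x)).2.2.2.2.2) x y

/-- All darts of the planarization outside of the triangles lie on one facial circuit. -/
theorem sameFace_of_face_eq_none (hL : L.OneFace) (y : X) (p : L.embedding.PlanDart)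
    (hp : L.planMark L.face p = none) : L.SameFace (L.edgeDart (.out (.plain y 0))) p := by
  have hl : ∀ x, L.SameFace (L.edgeDart (.out (.plain y 0))) (L.edgeDart (.out (.left x))) :=
    fun x => by
      have := (L.sameFace_plain_plain hL y (L.next.symm x)).trans
        (L.sameFace_plain_left_next (L.next.symm x))
      rwa [Equiv.apply_symm_apply] at this
  rcases L.planDart_cases p with ⟨s, rfl⟩ | ⟨s, h, rfl⟩
  · rw [planMark_edgeDart] at hp
    rcases s with x | (x | x | ⟨x, i⟩) | (x | x | ⟨x, i⟩)
    · exact absurd hp (by simp [face])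
    · exact hl x
    · exact absurd hp (by simp [face])
    · exact (L.sameFace_plain_plain hL y x).trans (L.sameFace_plain x i)
    · exact (hl x).trans (L.sameFace_left x).2.2.2.1
    · have := (hl (L.mate x)).trans (L.sameFace_left (L.mate x)).2.1
      rwa [L.mate_mate] at this
    · exact ((L.sameFace_plain_plain hL y x).trans (L.sameFace_plain x i)).trans
        (L.sameFace_out_inn_plain x i)
  · rw [planMark_crossDart] at hp
    rcases s with x | (x | x | ⟨x, i⟩) | (x | x | ⟨x, i⟩)
    · exact absurd rfl h
    · exact absurd hp (by simp [face])
    · have := (hl (L.mate x)).trans (L.sameFace_left (L.mate x)).2.2.2.2.1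
      simpa only [L.mate_mate] using this
    · exact absurd rfl h
    · exact (hl x).trans (L.sameFace_left x).2.2.1
    · have := (hl (L.mate x)).trans (L.sameFace_left (L.mate x)).1
      simpa only [L.mate_mate] using this
    · exact absurd rfl h

theorem sameFace_of_face_eq_some (x : X) (p : L.embedding.PlanDart)
    (hp : L.planMark L.face p = some x) : L.SameFace (L.edgeDart (.link x)) p := by
  have h1 : L.SameFace (L.edgeDart (.link x)) (L.edgeDart (.out (.right (L.mate x)))) :=
    .step (L.planFace_edgeDart (L.cross_link x))
  have h2 : L.SameFace (L.edgeDart (.out (.right (L.mate x))))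
      (L.crossDart (.out (.left x)) (L.cross_crossedSlot_ne (_, false, true))) := by
    refine .step ((L.planFace_edgeDart_of_ne
      (L.cross_crossedSlot_ne (L.mate x, true, true))).trans (L.crossDart_congr _ _ ?_))
    rw [crossedSlot, cross_out_right, L.mate_mate]
  rcases L.planDart_cases p with ⟨s, rfl⟩ | ⟨s, h, rfl⟩
  · rw [planMark_edgeDart] at hp
    rcases s with y | (y | y | ⟨y, i⟩) | t
    · obtain rfl : y = x := Option.some_injective _ hp
      exact .refl _ _
    · exact absurd hp (by simp [face])
    · obtain rfl : L.mate y = x := Option.some_injective _ hp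
      rwa [L.mate_mate] at h1
    · exact absurd hp (by simp [face])
    · exact absurd hp (by simp [face])
  · rw [planMark_crossDart] at hp
    rcases s with y | (y | y | ⟨y, i⟩) | t
    · exact absurd rfl h
    · obtain rfl : y = x := Option.some_injective _ hp
      exact h1.trans h2
    · exact absurd hp (by simp [face])
    · exact absurd rfl h
    · exact absurd hp (by simp [face])

theorem numCycles_planFace [Nonempty X] (hL : L.OneFace) :
    OnePlaneEmbedding.numCycles L.embedding.planFace = Nat.card (Option X) := by
  refine OnePlaneEmbedding.numCycles_eq_card _ (L.planMark L.face) ?_ fun p q =>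
    ⟨fun h => h.eq_of_invariant L.face_planFace, fun h => ?_⟩
  · rintro (_ | x)
    · exact ⟨L.edgeDart (.out (.left (Classical.arbitrary X))), L.planMark_edgeDart _ _⟩
    · exact ⟨L.edgeDart (.link x), L.planMark_edgeDart _ _⟩
  · cases hq : L.planMark L.face q with
    | none =>
      rw [hq] at h
      exact (L.sameFace_of_face_eq_none hL (Classical.arbitrary X) p h).symm.trans
        (L.sameFace_of_face_eq_none hL _ q hq)
    | some x =>
      rw [hq] at h
      exact (L.sameFace_of_face_eq_some x p h).symm.trans (L.sameFace_of_face_eq_some x q hq)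

/-! ### The embedding is outer-1-planar -/

theorem adj_out (t : L.Twig) : L.graph.Adj (.inl (L.vert t.base)) (.inr t) :=
  ⟨.out t, rfl, rfl⟩

theorem graph_connected [Nonempty X] (hv : Function.Surjective L.vert) (hL : L.OneFace) :
    L.graph.Connected := by
  have hX : ∀ x y, L.graph.Reachable (.inl (L.vert x)) (.inl (L.vert y)) := by
    refine hL (fun x y => L.graph.Reachable (.inl (L.vert x)) (.inl (L.vert y)))
      ⟨fun _ => .refl _, .symm, .trans⟩ fun x => ?_
    have h : L.vert x = L.vert (L.next x) :=
      (L.next_sameCycle _ _).1 (Equiv.Perm.SameCycle.step rfl)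
    rw [h]
    exact SimpleGraph.Adj.reachable ⟨.link (L.next x), rfl, rfl⟩
  have hV : ∀ v : L.Vertex, ∃ x, L.graph.Reachable (.inl (L.vert x)) v := by
    rintro (b | t)
    · obtain ⟨x, rfl⟩ := hv b
      exact ⟨x, .refl _⟩
    · exact ⟨t.base, (L.adj_out t).reachable⟩
  have : Nonempty L.Vertex := ⟨.inl (L.vert (Classical.arbitrary X))⟩
  refine ⟨fun v w => ?_⟩
  obtain ⟨x, hx⟩ := hV v
  obtain ⟨y, hy⟩ := hV w
  exact (hx.symm.trans (hX x y)).trans hy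

/-- If the skeleton is a plane tree (connected, with a single face and one link less than
vertices), then adding the leaves gives an outer-1-plane graph. -/
theorem isConnectedOuterOnePlane [Finite B] [Finite X] [Nonempty X]
    (hv : Function.Surjective L.vert) (hL : L.OneFace) (hcard : 2 * Nat.card B = Nat.card X + 2) :
    L.embedding.IsConnectedOuterOnePlane where
  connected := L.graph_connected hv hL
  euler := by
    have h1 := L.two_mul_numCycles_planRev
    rw [L.numCycles_planRot hv, L.numCycles_planFace hL]
    have h2 := Nat.card_congr L.twigEquiv
    have h3 := Nat.card_congr L.slotEquivSum
    have hb : Nat.card Bool = 2 := by simp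
    simp only [Nat.card_sum, Nat.card_prod, Finite.card_option, hb] at h1 h2 h3 ⊢
    omega
  outer := by
    refine ⟨L.edgeDart (.out (.plain (Classical.arbitrary X) 0)), ?_⟩
    rintro (b | t)
    · obtain ⟨x, rfl⟩ := hv b
      exact ⟨L.slotEquiv (.out (.left x)), rfl,
        L.sameFace_of_face_eq_none hL _ _ (L.planMark_edgeDart _ _)⟩
    · exact ⟨L.slotEquiv (.inn t), rfl,
        L.sameFace_of_face_eq_none hL _ _ (by
          rcases t with x | x | ⟨x, i⟩ <;> exact L.planMark_edgeDart _ _)⟩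

end LinkMap

namespace LinkMap

variable {B X : Type} (L : LinkMap B X)

/-! ### Straight links -/

/-- The three consecutive darts at the end `x` of a link: the link between its two crossed leaf
edges. -/
def trio (x : X) : Fin 3 → L.Slot
  | 0 => .out (.left x)
  | 1 => .link x
  | 2 => .out (.right x)

theorem trio_tail (x : X) (j : Fin 3) : (L.trio x j).tail = .inl (L.vert x) := by
  fin_cases j <;> rfl

/-- The end of a link to which a dart is assigned. -/
def Slot.base {L : LinkMap B X} : L.Slot → X
  | .link x => x
  | .out t => t.base
  | .inn t => t.base

/-- The number of the dart in the counterclockwise order at its end `x`, starting with `left x`. A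
dart that leaves a leaf is alone and gets number `0`. -/
def Slot.rank {L : LinkMap B X} : L.Slot → ℕ
  | .link _ => 1
  | .out (.left _) => 0
  | .out (.right _) => 2
  | .out (.plain _ i) => i + 3
  | .inn _ => 0

theorem base_trio (x : X) (j : Fin 3) : (L.trio x j).base = x := by
  fin_cases j <;> rfl

theorem rank_trio_le (x : X) (j : Fin 3) : (L.trio x j).rank ≤ 2 := by
  fin_cases j <;> simp [trio, Slot.rank]

theorem base_rot (s : L.Slot) (h : s.rank < L.extra s.base + 3) :
    (L.rot s).base = s.base ∧ (L.rot s).rank ≤ s.rank + 1 := by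
  rcases s with x | (x | x | ⟨x, i⟩) | t
  · exact ⟨rfl, le_rfl⟩
  · exact ⟨rfl, le_rfl⟩
  · exact ⟨rfl, le_rfl⟩
  · induction i using Fin.lastCases with
    | last => simp [Slot.rank, Slot.base, Twig.base] at h
    | cast j =>
      rw [rot_castSucc]
      refine ⟨rfl, ?_⟩
      simp only [Slot.rank, Fin.val_succ, Fin.val_castSucc]
      omega
  · exact ⟨rfl, Nat.le_succ _⟩

theorem base_rot_iterate (s : L.Slot) (i : ℕ) (h : s.rank + i ≤ L.extra s.base + 3) :
    (L.rot^[i] s).base = s.base ∧ (L.rot^[i] s).rank ≤ s.rank + i := by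
  induction i with
  | zero => exact ⟨rfl, le_rfl⟩
  | succ i ih =>
    obtain ⟨h1, h2⟩ := ih (by omega)
    obtain ⟨h3, h4⟩ := L.base_rot (L.rot^[i] s) (by rw [h1]; omega)
    rw [Function.iterate_succ_apply']
    exact ⟨h3.trans h1, by omega⟩

theorem embedding_rot_iterate (s : L.Slot) (i : ℕ) :
    L.embedding.rot^[i] (L.slotEquiv s) = L.slotEquiv (L.rot^[i] s) := by
  have h : Function.Semiconj L.slotEquiv L.rot L.embedding.rot := fun s =>
    (L.embedding_rot s).symm
  exact (h.iterate_right i s).symm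

variable {L} {Γ : VisibilityRep L.graph}

/-- If there are many leaves between any two links, then the darts around two different links of a
vertex do not leave the same vertical side of its box. -/
theorem dir_trio_ne [Finite B] [Finite X] (hΓ : Γ.EmbeddingPreserving L.embedding)
    (hH : ∀ x, Γ.height ≤ L.extra x + 1) {x y : X} (hv : L.vert x = L.vert y) (hxy : x ≠ y)
    (i j : Fin 3) (hh : Γ.dir (L.slotEquiv (L.trio x i)) = 0 ∨
      Γ.dir (L.slotEquiv (L.trio x i)) = 2) :
    Γ.dir (L.slotEquiv (L.trio x i)) ≠ Γ.dir (L.slotEquiv (L.trio y j)) := by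
  intro hdir
  obtain ⟨n, hn, h⟩ := hΓ.not_far (by simp only [slotEquiv_fst, trio_tail, hv]) hdir hh
  simp only [embedding_rot_iterate, EmbeddingLike.apply_eq_iff_eq] at h
  have key : ∀ (x y : X) (i j : Fin 3), L.rot^[n] (L.trio x i) = L.trio y j → x = y := by
    intro x y i j h
    have h1 := (L.base_rot_iterate (L.trio x i) n (by
      have := hH x
      have := L.rank_trio_le x i
      rw [base_trio]
      omega)).1
    rwa [h, base_trio, base_trio, eq_comm] at h1
  rcases h with h | h
  · exact hxy (key x y i j h)
  · exact hxy (key y x j i h).symm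

variable (Γ) in
/-- At the end `x`, the link and its two crossed leaf edges leave the box in direction `δ`, which
is upward or downward. -/
def Straight (x : X) (δ : Fin 4) : Prop :=
  (δ = 1 ∨ δ = 3) ∧ ∀ j, Γ.dir (L.slotEquiv (L.trio x j)) = δ

/-- `EmbeddingPreserving.link` for a link of the skeleton. -/
theorem link_dirs (hΓ : Γ.EmbeddingPreserving L.embedding) (x : X)
    (hx : ∀ j, Γ.dir (L.slotEquiv (L.trio x j)) = 1 ∨ Γ.dir (L.slotEquiv (L.trio x j)) = 3) :
    Γ.dir (L.slotEquiv (.out (.left x))) = Γ.dir (L.slotEquiv (.link x)) ∧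
    Γ.dir (L.slotEquiv (.out (.right x))) = Γ.dir (L.slotEquiv (.link x)) ∧
    Γ.dir (L.slotEquiv (.out (.left (L.mate x)))) = Γ.dir (L.slotEquiv (.link x)) + 1 ∧
    Γ.dir (L.slotEquiv (.link x)) = Γ.dir (L.slotEquiv (.out (.right (L.mate x)))) + 1 := by
  refine hΓ.link (l := L.slotEquiv (.out (.left x))) (r := L.slotEquiv (.out (.right x)))
    rfl rfl rfl rfl ?_ ?_ ?_ ?_ (hx 0) (hx 1) (hx 2)
  · rw [embedding_cross, cross_out_right]
  · simp
  · rw [embedding_cross, cross_out_right, L.mate_mate]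
  · rw [ne_eq, EmbeddingLike.apply_eq_iff_eq]
    simp

theorem straight_of_vertical (hΓ : Γ.EmbeddingPreserving L.embedding) (x : X)
    (hx : ∀ j, Γ.dir (L.slotEquiv (L.trio x j)) = 1 ∨ Γ.dir (L.slotEquiv (L.trio x j)) = 3) :
    ∃ δ, Straight Γ x δ := by
  obtain ⟨h1, h2, -, -⟩ := link_dirs hΓ x hx
  refine ⟨_, hx 1, fun j => ?_⟩
  fin_cases j
  · exact h1
  · rfl
  · exact h2

/-- A straight link occupies both vertical sides of the box at its far end, so from there every
other link goes on straight in the same direction. -/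
theorem Straight.next [Finite B] [Finite X] (hΓ : Γ.EmbeddingPreserving L.embedding)
    (hH : ∀ x, Γ.height ≤ L.extra x + 1) {x : X} {δ : Fin 4} (hx : Straight Γ x δ) {z : X}
    (hz : L.vert z = L.vert (L.mate x)) (hne : z ≠ L.mate x) : Straight Γ z δ := by
  obtain ⟨hδ, hx⟩ := hx
  refine ⟨hδ, fun j => ?_⟩
  obtain ⟨-, -, hl, hr⟩ := link_dirs hΓ x fun j => by rwa [hx j]
  have hm : Γ.dir (L.slotEquiv (.link x)) = δ := hx 1
  have hm' : Γ.dir (L.slotEquiv (.link (L.mate x))) = δ + 2 := by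
    rw [← hm, ← Γ.dir_symm, slotEquiv_symm]
    rfl
  rw [hm] at hl hr
  have hrot1 : L.embedding.rot (L.slotEquiv (.out (.left (L.mate x)))) =
      L.slotEquiv (.link (L.mate x)) := L.embedding_rot _
  have hrot2 : L.embedding.rot (L.slotEquiv (.link (L.mate x))) =
      L.slotEquiv (.out (.right (L.mate x))) := L.embedding_rot _
  have h1 : Γ.dir (L.slotEquiv (L.trio z j)) ≠ δ + 2 := by
    intro h
    have := hΓ.eq_rot_of_dir_eq (d := L.slotEquiv (.out (.left (L.mate x))))
      (f := L.slotEquiv (L.trio z j)) (by simp only [slotEquiv_fst, trio_tail, hz]; rfl)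
      (by rw [hrot1, hl, hm', add_assoc]; rfl)
      (by
        rw [hrot1, hrot2, hm', hr]
        exact (by decide : ∀ ρ : Fin 4, ρ + 1 + 2 + 1 = ρ) _)
      (by rw [hrot1, h, hm'])
    rw [hrot1, EmbeddingLike.apply_eq_iff_eq] at this
    have := congrArg Slot.base this
    rw [base_trio] at this
    exact hne this
  have h2 : δ + 1 = 0 ∨ δ + 1 = 2 → δ + 1 ≠ Γ.dir (L.slotEquiv (L.trio z j)) := by
    rw [← hl]
    exact dir_trio_ne hΓ hH hz.symm hne.symm 0 j
  have h3 := dir_trio_ne hΓ hH hz.symm hne.symm 2 j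
  have key : ∀ δ ρ ζ : Fin 4, (δ = 1 ∨ δ = 3) → δ = ρ + 1 → ζ ≠ δ + 2 →
      (δ + 1 = 0 ∨ δ + 1 = 2 → δ + 1 ≠ ζ) → (ρ = 0 ∨ ρ = 2 → ρ ≠ ζ) → ζ = δ := by
    decide
  exact key _ _ _ hδ hr h1 h2 h3

/-- Each vertical side of a box serves at most one link, so one of three links is straight. -/
theorem exists_straight [Finite B] [Finite X] (hΓ : Γ.EmbeddingPreserving L.embedding)
    (hH : ∀ x, Γ.height ≤ L.extra x + 1) (y : Fin 3 → X) (hy : Function.Injective y)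
    (hv : ∀ i j, L.vert (y i) = L.vert (y j)) : ∃ i δ, Straight Γ (y i) δ := by
  by_contra! hcon
  have h : ∀ i, ∃ j, Γ.dir (L.slotEquiv (L.trio (y i) j)) = 0 ∨
      Γ.dir (L.slotEquiv (L.trio (y i) j)) = 2 := by
    intro i
    by_contra! h
    obtain ⟨δ, hδ⟩ := straight_of_vertical hΓ (y i) fun j => by
      have := h j
      generalize Γ.dir (L.slotEquiv (L.trio (y i) j)) = ζ at this
      revert ζ
      decide
    exact hcon i δ hδ
  choose j hj using h
  obtain ⟨a, b, hab, h⟩ := Fintype.exists_ne_map_eq_of_card_lt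
    (fun i => decide (Γ.dir (L.slotEquiv (L.trio (y i) (j i))) = 0)) (by simp)
  refine dir_trio_ne hΓ hH (hv a b) (hy.ne hab) (j a) (j b) (hj a) ?_
  have ha := hj a
  have hb := hj b
  rw [decide_eq_decide] at h
  rcases ha with ha | ha
  · rw [ha, h.1 ha]
  · rcases hb with hb | hb
    · rw [hb, h.2 hb]
    · rw [ha, hb]

/-- A path of links that starts straight needs a new row for each of its vertices. -/
theorem Straight.le_height [Finite B] [Finite X] (hΓ : Γ.EmbeddingPreserving L.embedding)
    (hH : ∀ x, Γ.height ≤ L.extra x + 1) {n : ℕ} (y : Fin (n + 1) → X)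
    (hy : ∀ j : Fin n, L.vert (y j.succ) = L.vert (L.mate (y j.castSucc)) ∧
      y j.succ ≠ L.mate (y j.castSucc)) {δ : Fin 4} (h0 : Straight Γ (y 0) δ) :
    n + 1 ≤ Γ.height := by
  have hs : ∀ j, Straight Γ (y j) δ := by
    intro j
    induction j using Fin.induction with
    | zero => exact h0
    | succ j ih => exact ih.next hΓ hH (hy j).1 (hy j).2
  have hinj : Function.Injective fun j => Γ.top (.inl (L.vert (y j))) := by
    rcases h0.1 with hδ | hδ
    · refine (Fin.strictMono_iff_lt_succ.2 fun j => ?_).injective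
      have h1 : Γ.dir (L.slotEquiv (.link (y j.castSucc))) = 1 := ((hs _).2 1).trans hδ
      have h2 := VisibilityRep.top_lt_bottom_of_dir_eq_one h1
      have h3 := Γ.bottom_le_top (.inl (L.vert (y j.succ)))
      rw [(hy j).1] at h3 ⊢
      exact lt_of_lt_of_le h2 h3
    · refine (Fin.strictAnti_iff_succ_lt.2 fun j => ?_).injective
      have h1 : Γ.dir (L.slotEquiv (.link (y j.castSucc))) = 3 := ((hs _).2 1).trans hδ
      have h2 := VisibilityRep.top_lt_bottom_of_dir_eq_three h1
      have h3 := Γ.bottom_le_top (.inl (L.vert (y j.castSucc)))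
      rw [(hy j).1]
      exact lt_of_lt_of_le h2 h3
  have hc := Γ.card_le_height_of_injOn Finset.univ
    (fun j => Γ.top (.inl (L.vert (y j)))) hinj.injOn fun j _ =>
      ⟨Γ.left (.inl (L.vert (y j))), Or.inl (Set.mem_iUnion.2 ⟨.inl (L.vert (y j)),
        Γ.mem_box.2 ⟨⟨le_rfl, Γ.left_le_right _⟩, Γ.bottom_le_top _, le_rfl⟩⟩)⟩
  simpa using hc

end LinkMap

/-! ### Spiders -/

/-- The vertices of the legs of a spider: `(i, j)` is the vertex number `j` of leg `i`. -/
abbrev LegVertex (k : ℕ) : Type := Fin 3 × Fin (k + 1)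

namespace LegVertex

/-- The neighbour of a leg vertex towards the centre of the spider, which is `none`. -/
def parent {k : ℕ} (v : LegVertex k) : Option (LegVertex k) :=
  Fin.cases (motive := fun _ => Option (LegVertex k)) none (fun j => some (v.1, j.castSucc)) v.2

theorem parent_zero {k : ℕ} (i : Fin 3) : parent ((i, 0) : LegVertex k) = none := rfl

theorem parent_succ {k : ℕ} (i : Fin 3) (j : Fin k) :
    parent ((i, j.succ) : LegVertex k) = some (i, j.castSucc) := rfl

theorem lt_of_parent_eq {k : ℕ} {v w : LegVertex k} (h : v.parent = some w) : w.2 < v.2 := by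
  obtain ⟨i, j⟩ := v
  induction j using Fin.cases with
  | zero => rw [parent_zero] at h; exact absurd h (by simp)
  | succ j =>
    rw [parent_succ] at h
    obtain rfl := Option.some_injective _ h
    exact Fin.castSucc_lt_succ

end LegVertex

open LegVertex in
/-- The rotation of a spider. The link between `v` and its parent has the end `(v, true)` at `v`
and the end `(v, false)` at the parent. -/
def spiderNext (k : ℕ) : Equiv.Perm (LegVertex k × Bool) where
  toFun
    | ((i, j), true) => Fin.lastCases (motive := fun _ => LegVertex k × Bool)
        ((i, Fin.last k), true) (fun j => ((i, j.succ), false)) j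
    | ((i, j), false) => Fin.cases (motive := fun _ => LegVertex k × Bool)
        ((i + 1, 0), false) (fun j => ((i, j.castSucc), true)) j
  invFun
    | ((i, j), true) => Fin.lastCases (motive := fun _ => LegVertex k × Bool)
        ((i, Fin.last k), true) (fun j => ((i, j.succ), false)) j
    | ((i, j), false) => Fin.cases (motive := fun _ => LegVertex k × Bool)
        ((i - 1, 0), false) (fun j => ((i, j.castSucc), true)) j
  left_inv := by
    rintro ⟨⟨i, j⟩, _ | _⟩
    · induction j using Fin.cases <;> simp
    · induction j using Fin.lastCases <;> simp
  right_inv := by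
    rintro ⟨⟨i, j⟩, _ | _⟩
    · induction j using Fin.cases <;> simp
    · induction j using Fin.lastCases <;> simp

section

variable {k : ℕ} (i : Fin 3)

theorem spiderNext_last : spiderNext k ((i, Fin.last k), true) = ((i, Fin.last k), true) := by
  simp [spiderNext]

theorem spiderNext_castSucc (j : Fin k) :
    spiderNext k ((i, j.castSucc), true) = ((i, j.succ), false) := by
  simp [spiderNext]

theorem spiderNext_zero : spiderNext k ((i, 0), false) = ((i + 1, 0), false) := rfl

theorem spiderNext_succ (j : Fin k) :
    spiderNext k ((i, j.succ), false) = ((i, j.castSucc), true) := rfl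

end

/-- The vertex of an end of a link of the spider. -/
def spiderVert {k : ℕ} : LegVertex k × Bool → Option (LegVertex k)
  | (v, true) => some v
  | (v, false) => v.parent

theorem spiderVert_next {k : ℕ} (x : LegVertex k × Bool) :
    spiderVert (spiderNext k x) = spiderVert x := by
  obtain ⟨⟨i, j⟩, _ | _⟩ := x
  · induction j using Fin.cases <;> rfl
  · induction j using Fin.lastCases with
    | last => rw [spiderNext_last]
    | cast j => rw [spiderNext_castSucc]; rfl

theorem spiderNext_sameCycle {k : ℕ} (x y : LegVertex k × Bool) :
    (spiderNext k).SameCycle x y ↔ spiderVert x = spiderVert y := by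
  refine ⟨fun h => h.eq_of_invariant spiderVert_next, fun h => ?_⟩
  -- a representative end for every vertex
  have key : ∀ x, (spiderNext k).SameCycle
      ((spiderVert x).elim ((0, 0), false) fun v => (v, true)) x := by
    rintro ⟨⟨i, j⟩, _ | _⟩
    · induction j using Fin.cases with
      | zero =>
        have h1 : ∀ i : Fin 3, (spiderNext k).SameCycle ((i, 0), false) ((i + 1, 0), false) :=
          fun i => .step (spiderNext_zero i)
        fin_cases i
        · exact .refl _ _
        · exact h1 0
        · exact (h1 0).trans (h1 1)
      | succ j => exact .symm (.step (spiderNext_succ i j))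
    · exact .refl _ _
  have hx := key x
  rw [h] at hx
  exact hx.symm.trans (key y)

/-- The spider with three legs of `k + 1` vertices. There are `m + 1` plain leaves in one of the
angles at the centre, and `k + 1` in all other angles. -/
def spider (k m : ℕ) : LinkMap (Option (LegVertex k)) (LegVertex k × Bool) where
  vert := spiderVert
  next := spiderNext k
  mate x := (x.1, !x.2)
  extra x := if x = ((0, 0), false) then m else k
  mate_mate x := by simp
  next_sameCycle := spiderNext_sameCycle
  vert_mate_ne := by
    rintro ⟨v, _ | _⟩ h
    · exact lt_irrefl _ (LegVertex.lt_of_parent_eq h.symm)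
    · exact lt_irrefl _ (LegVertex.lt_of_parent_eq h)
  eq_of_vert_eq := by
    rintro ⟨v, _ | _⟩ ⟨w, _ | _⟩ h h'
    · exact congrArg (·, false) (Option.some_injective _ h')
    · exact absurd (LegVertex.lt_of_parent_eq h) (LegVertex.lt_of_parent_eq h'.symm).asymm
    · exact absurd (LegVertex.lt_of_parent_eq h') (LegVertex.lt_of_parent_eq h.symm).asymm
    · exact congrArg (·, true) (Option.some_injective _ h)

namespace spider

variable (k m : ℕ)

theorem extra_eq (x : LegVertex k × Bool) :
    (spider k m).extra x = if x = ((0, 0), false) then m else k := rfl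

theorem vert_surjective : Function.Surjective (spider k m).vert := by
  rintro (_ | v)
  · exact ⟨((0, 0), false), rfl⟩
  · exact ⟨(v, true), rfl⟩

/-- The circuit around the spider runs outwards along one side of every leg and back along the
other side, and then changes to the next leg. -/
theorem oneFace : (spider k m).OneFace := by
  intro r hr h
  have h1 : ∀ i j, r ((i, j), true) ((i, 0), true) := by
    intro i j
    induction j using Fin.induction with
    | zero => exact hr.refl _
    | succ j ih =>
      have := h ((i, j.castSucc), true)
      simp only [spider, spiderNext_castSucc] at this
      exact hr.trans (hr.symm this) ih
  have h2 : ∀ i j, r ((i, j), false) ((i, 0), false) := by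
    intro i j
    induction j using Fin.induction with
    | zero => exact hr.refl _
    | succ j ih => exact hr.trans (h ((i, j.succ), false)) ih
  have h3 : ∀ i, r ((i, 0), true) ((i, 0), false) := by
    intro i
    have := h ((i, Fin.last k), true)
    simp only [spider, spiderNext_last] at this
    exact hr.trans (hr.symm (h1 i _)) (hr.trans this (h2 i _))
  have h4 : ∀ i : Fin 3, r ((i, 0), true) ((i + 1, 0), true) := fun i =>
    hr.trans (h3 i) (h ((i, 0), false))
  have h5 : ∀ i : Fin 3, r ((i, 0), true) ((0, 0), true) := by
    intro i
    fin_cases i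
    · exact hr.refl _
    · exact hr.symm (h4 0)
    · exact hr.symm (hr.trans (h4 0) (h4 1))
  have h6 : ∀ x, r x ((0, 0), true) := by
    rintro ⟨⟨i, j⟩, _ | _⟩
    · exact hr.trans (h2 i j) (hr.trans (hr.symm (h3 i)) (h5 i))
    · exact hr.trans (h1 i j) (h5 i)
  exact fun x y => hr.trans (h6 x) (hr.symm (h6 y))

theorem isConnectedOuterOnePlane : (spider k m).embedding.IsConnectedOuterOnePlane := by
  refine (spider k m).isConnectedOuterOnePlane (vert_surjective k m) (oneFace k m) ?_
  simp only [Nat.card_eq_fintype_card, Fintype.card_option, Fintype.card_prod, Fintype.card_fin,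
    Fintype.card_bool]
  ring

theorem card_vertex : Nat.card (spider k m).Vertex + k =
    15 * (k + 1) + 1 + 6 * (k + 1) ^ 2 + m := by
  have h1 := Nat.card_congr (spider k m).twigEquiv
  have h2 : ∑ x, ((spider k m).extra x + 1) + k = 6 * (k + 1) ^ 2 + m := by
    have h3 : ∀ x, (spider k m).extra x + 1 + (if x = ((0, 0), false) then k else 0) =
        k + 1 + (if x = ((0, 0), false) then m else 0) := by
      intro x
      rw [extra_eq]
      split_ifs <;> omega
    have h4 := Finset.sum_congr (rfl : (Finset.univ : Finset (LegVertex k × Bool)) = _)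
      fun x _ => h3 x
    simp only [Finset.sum_add_distrib, Finset.sum_ite_eq', Finset.mem_univ, if_true,
      Finset.sum_const, Finset.card_univ, Fintype.card_prod, Fintype.card_fin, Fintype.card_bool,
      smul_eq_mul] at h4 ⊢
    rw [h4]
    ring
  simp only [Nat.card_sum, Nat.card_sigma] at h1 ⊢
  simp only [Nat.card_eq_fintype_card, Fintype.card_fin, Fintype.card_option, Fintype.card_prod,
    Fintype.card_bool] at h1 ⊢
  omega

variable {k m} {Γ : VisibilityRep (spider k m).graph}

/-- The ends `((i, 0), false)` are the three ends at the centre, and `((i, j), false)` leads from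
the `j`-th vertex of the path along leg `i`, counted from the centre, to the next one. -/
theorem lt_height (hkm : k ≤ m) (hΓ : Γ.EmbeddingPreserving (spider k m).embedding) :
    k + 1 ≤ Γ.height := by
  by_contra! hlt
  have hH : ∀ x, Γ.height ≤ (spider k m).extra x + 1 := by
    intro x
    rw [extra_eq]
    split_ifs <;> omega
  obtain ⟨i, δ, h⟩ := LinkMap.exists_straight hΓ hH (fun i => ((i, 0), false))
    (fun i j h => by simpa using h) fun i j => rfl
  have := h.le_height hΓ hH (fun j => ((i, j), false)) fun j =>
    ⟨LegVertex.parent_succ i j, fun h => by simp [spider] at h⟩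
  omega

theorem lt_width (hkm : k ≤ m) (hΓ : Γ.EmbeddingPreserving (spider k m).embedding) :
    k + 1 ≤ Γ.width := by
  rw [← VisibilityRep.height_rotate]
  exact lt_height hkm hΓ.rotate

theorem lt_two_mul_width_add_two_mul_height (Γ : VisibilityRep (spider k m).graph) :
    m + 1 ≤ 2 * Γ.width + 2 * Γ.height := by
  classical
  have hinj : Function.Injective fun i : Fin (m + 1) =>
      (spider k m).slotEquiv (.out (.plain ((0, 0), false) i)) := by
    intro i j h
    have h' := LinkMap.Slot.out.inj ((spider k m).slotEquiv.injective h)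
    exact eq_of_heq (LinkMap.Twig.plain.inj h').2
  have h := Γ.card_darts_le (Finset.univ.image fun i : Fin (m + 1) =>
    (spider k m).slotEquiv (.out (.plain ((0, 0), false) i))) (.inl none) (by
      intro d hd
      obtain ⟨i, -, rfl⟩ := Finset.mem_image.1 hd
      rfl)
  rwa [Finset.card_image_of_injective _ hinj, Finset.card_univ, Fintype.card_fin] at h

end spider

theorem theorem1 :
    ∃ c : ℝ, 0 < c ∧ ∀ N : ℕ,
      ∃ (V : Type) (_ : Fintype V) (G : SimpleGraph V) (E : OnePlaneEmbedding G),
        E.IsConnectedOuterOnePlane ∧ N ≤ Fintype.card V ∧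
        ∀ Γ : VisibilityRep G, Γ.EmbeddingPreserving E →
          c * (Fintype.card V : ℝ) ^ (3 / 2 : ℝ) ≤ (Γ.area : ℝ) := by
  -- with `q = N + 1`, there are at most `(5 * q) ^ 2` vertices and the area is at least
  -- `q ^ 3 / 4 = (5 * q) ^ 3 / 500`
  refine ⟨1 / 500, by norm_num, fun N => ?_⟩
  set q := N + 1 with hq
  have hcard := spider.card_vertex N (q ^ 2)
  let _ : Fintype (spider N (q ^ 2)).Vertex := Fintype.ofFinite _
  refine ⟨(spider N (q ^ 2)).Vertex, inferInstance, (spider N (q ^ 2)).graph,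
    (spider N (q ^ 2)).embedding, spider.isConnectedOuterOnePlane _ _, ?_, fun Γ hΓ => ?_⟩
  · rw [← Nat.card_eq_fintype_card]
    omega
  · rw [← Nat.card_eq_fintype_card]
    have hNm : N ≤ q ^ 2 := by nlinarith
    have hh := spider.lt_height hNm hΓ
    have hw := spider.lt_width hNm hΓ
    have hs := spider.lt_two_mul_width_add_two_mul_height Γ
    have hn : Nat.card (spider N (q ^ 2)).Vertex ≤ (5 * q) ^ 2 := by nlinarith
    have hn' : (Nat.card (spider N (q ^ 2)).Vertex : ℝ) ≤ (5 * q : ℝ) ^ (2 : ℝ) := by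
      rw [Real.rpow_two]
      exact_mod_cast hn
    have hpow : (Nat.card (spider N (q ^ 2)).Vertex : ℝ) ^ (3 / 2 : ℝ) ≤ (5 * q : ℝ) ^ 3 := by
      calc _ ≤ ((5 * q : ℝ) ^ (2 : ℝ)) ^ (3 / 2 : ℝ) :=
            Real.rpow_le_rpow (by positivity) hn' (by norm_num)
        _ = (5 * q : ℝ) ^ (3 : ℝ) := by
            rw [← Real.rpow_mul (by positivity)]
            norm_num
        _ = (5 * q : ℝ) ^ 3 := by
            rw [← Real.rpow_natCast]
            norm_num
    -- the larger dimension is at least `q ^ 2 / 4` and the smaller one at least `q`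
    have harea : q ^ 3 ≤ 4 * (Γ.width * Γ.height) := by
      rcases le_total Γ.width Γ.height with h | h
      · nlinarith [Nat.mul_le_mul hw (show q ^ 2 ≤ 4 * Γ.height by omega)]
      · nlinarith [Nat.mul_le_mul hh (show q ^ 2 ≤ 4 * Γ.width by omega)]
    have harea' : (q : ℝ) ^ 3 ≤ 4 * (Γ.area : ℝ) := by
      rw [VisibilityRep.area]
      exact_mod_cast harea
    nlinarith
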